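/- **Theorem (Value iteration for optimal stopping of semi-Markov processes with finite horizon).** *Setting.* Let $E$ be a Borel space, and let $Q(\cdot,\cdot|x)$ be a semi-Markov kernel on $\mathbb R_+\times E$ given $E$. This means: $Q(t,B|x)$ is non-decreasing and right continuous in $t$ with $Q(0,B|x)=0$; $Q(t,\cdot|\cdot)$ is a sub-stochastic kernel for each $t\ge 0$; and $\lim_{t\to\infty}Q(t,\cdot|\cdot)$ is a stochastic kernel. Let $c,g:E\to[0,\infty)$ be measurable and let $T\in[0,\infty)$. For $x\in E$ let $\mathbb P_x$ be the law of the marked point process $(X_0,T_1,X_1,T_2,X_2,\dots)$ with $X_0=x$ and $$\mathbb P_x(T_{n+1}\le t,\,X_{n+1}\in B\mid X_0,T_1,\dots,T_n,X_n)=Q(t,B|X_n).$$ Put $S_n=\sum_{k=1}^nT_k$ and $X(t)=X_n$ for $S_n\le t<S_{n+1}$. A stopping time is a map $\tau$ into $\mathbb N\cup\{\infty\}$ with $\{\tau=n\}\in\sigma(X_0,T_1,\dots,T_n,X_n)$ for all $n$; put $S_\infty=\infty$. For $s\ge0$ let $$V^*(s,x)=\inf_\tau\mathbb E_x[R^s_\tau],\qquad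 R^s_\tau=\begin{cases}\int_0^{S_\tau}c(X(t))\,dt+g(X(S_\tau)),&S_\tau<s,\\ \int_0^{s}c(X(t))\,dt,&S_\tau\ge s,\end{cases}$$ where the infimum is over all stopping times. For Borel measurable $u:[0,T]\times E\to[0,\infty]$ define $$\mathbb Gu(s,x)=\min\Big\{c(x)\int_0^s(1-Q(t,E|x))\,dt+\int_{[0,s]\times E}u(s-t,y)\,Q(dt,dy|x),\ g(x)\Big\}.$$ *The associated semi-Markov decision process.* Its states are $\hat E=E\cup\{\Delta\}$, its actions are $0$ (continue) and $1$ (stop), with admissible actions $A(x)=\{0,1\}$ for $x\in E$ and $A(\Delta)=\{1\}$. Its semi-Markov kernel is $\hat Q_T(t,B|x,0)=Q(t,B\setminus\{\Delta\}|x)$ for $x\in E$, and $\hat Q_T(t,B|x,1)=\mathbf 1_{[T+1,\infty)}(t)\,\delta_\Delta(B)$ for $x\in\hat E$. The cost rate is $\hat c(x,0)=c(x)$ for $x\in E$ and $\hat c=0$ otherwise; the terminal cost is $\hat g(x,1)=g(x)$ for $x\in E$ and $\hat g=0$ otherwise. A policy is a sequence $\pi=(\pi_n)$ of stochastic kernels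 $\pi_n(\cdot|r,\hat h_n)$ on the actions, given the remaining horizon $r\in\mathbb R$ and the history $\hat h_n=(x_0,a_0,t_1,x_1,\dots,a_{n-1},t_n,x_n)$, with $\pi_n(A(x_n)|r,\hat h_n)=1$. Under $\pi$, with initial horizon $s\ge0$ and initial state $x$, the action $A_n$ has conditional law $\pi_n(\cdot|s-\hat S_n,\hat h_n)$, where $\hat S_n=t_1+\dots+t_n$, and the next sojourn time and state have conditional law $\hat Q_T(dt,dy|\hat X_n,A_n)$. With $(\hat X(t),A(t))=(\hat X_n,A_n)$ for $\hat S_n\le t<\hat S_{n+1}$, put $$U^*(s,x)=\inf_\pi\hat{\mathbb E}^\pi_{(s,x)}\Big[\int_0^s\hat c(\hat X(t),A(t))\,dt+\hat g(\hat X(s),A(s))\Big],$$ where the infimum is over all policies. *Statement.* Assume there are $\delta>0$ and $\varepsilon>0$ with $Q(\delta,E|x)\le1-\varepsilon$ for all $x\in E$. Let $V^*_0\equiv0$ and $V^*_{n+1}=\mathbb GV^*_n$ for $n\ge0$. Then all $V_n^*$ and $V^*$ are Borel measurable on $[0,T]\times E$, and for all $(s,x)\in[0,T]\times E$: 1. $V^*(s,x)=\lim_{n\to\infty}V^*_n(s,x)$;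 2. $V^*(s,x)=\mathbb GV^*(s,x)$; 3. $V^*(s,x)=U^*(s,x)$. -/

import Mathlib

open MeasureTheory ProbabilityTheory Filter Topology
open scoped ENNReal NNReal

noncomputable section

universe u v

/-! ### Semi-Markov kernels -/

/-- A semi-Markov kernel on `ℝ₊ × S` given `α`, written as the probability kernel `Q(dt, dy | x)`.
The functions `Q(t, B | x)` of the literature are `Q(t, B | x) = Q([0,t] × B | x)`, see
`SemiMarkovKernel.cdf`; they are non-decreasing and right continuous in `t`, sub-stochastic in
`B`, measurable in `x`, and become stochastic as `t → ∞`.  The field `zero` is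
`Q(0, B | x) = 0`. -/
structure SemiMarkovKernel (α : Type v) (S : Type u) [MeasurableSpace α] [MeasurableSpace S] where
  toKernel : Kernel α (ℝ≥0 × S)
  isMarkov : IsMarkovKernel toKernel
  zero : ∀ x, toKernel x ({0} ×ˢ Set.univ) = 0

attribute [instance] SemiMarkovKernel.isMarkov

/-- `Q(t, B | x)`: the next jump happens within time `t` and leads into `B`. -/
def SemiMarkovKernel.cdf {α : Type v} {S : Type u} [MeasurableSpace α] [MeasurableSpace S]
    (Q : SemiMarkovKernel α S) (t : ℝ≥0) (B : Set S) (x : α) : ℝ≥0∞ :=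
  Q.toKernel x (Set.Iic t ×ˢ B)

/-- There are `δ, ε > 0` with `Q(δ, E | x) ≤ 1 - ε` for all `x`. -/
def SemiMarkovKernel.Regular {α : Type v} {S : Type u} [MeasurableSpace α] [MeasurableSpace S]
    (Q : SemiMarkovKernel α S) : Prop :=
  ∃ δ : ℝ≥0, 0 < δ ∧ ∃ ε : ℝ, 0 < ε ∧ ∀ x, (Q.cdf δ Set.univ x).toReal ≤ 1 - ε

/-! ### Sequence spaces: an initial entry in `α`, all later entries in `β` -/

/-- The type of the `n`-th entry of a sequence in `α × β × β × ⋯`. -/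
def Stage (α β : Type u) : ℕ → Type u
  | 0 => α
  | _ + 1 => β

instance Stage.instMeasurableSpace (α β : Type u) [hα : MeasurableSpace α]
    [hβ : MeasurableSpace β] : ∀ n, MeasurableSpace (Stage α β n)
  | 0 => hα
  | _ + 1 => hβ

/-! ### Semi-Markov processes and optimal stopping -/

namespace SMP

variable {E : Type u} [MeasurableSpace E]

/-- The sample space of all `(x₀, t₁, x₁, t₂, x₂, …)`. -/
abbrev Path (E : Type u) : Type u := (n : ℕ) → Stage E (ℝ≥0 × E) n

/-- The space of all histories `hₙ = (x₀, t₁, x₁, …, tₙ, xₙ)`. -/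
abbrev Hist (E : Type u) (n : ℕ) : Type u := (i : Finset.Iic n) → Stage E (ℝ≥0 × E) i

/-- The state contained in the `n`-th entry. -/
def stageState : (n : ℕ) → Stage E (ℝ≥0 × E) n → E
  | 0, x => x
  | _ + 1, p => p.2

/-- The sojourn time contained in the `n`-th entry (`T₀ = 0`). -/
def stageTime : (n : ℕ) → Stage E (ℝ≥0 × E) n → ℝ≥0
  | 0, _ => 0
  | _ + 1, p => p.1

theorem measurable_stageState : ∀ n, Measurable (stageState (E := E) n)
  | 0 => measurable_id
  | _ + 1 => measurable_snd

/-- `Xₙ`, the state at the `n`-th jump time. -/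
def state (n : ℕ) (ω : Path E) : E := stageState n (ω n)

/-- `Tₙ`, the `n`-th sojourn time (`T₀ = 0`). -/
def sojourn (n : ℕ) (ω : Path E) : ℝ≥0 := stageTime n (ω n)

/-- `Sₙ = T₀ + ⋯ + Tₙ`, the `n`-th jump time. -/
def jumpTime (n : ℕ) (ω : Path E) : ℝ≥0 := ∑ k ∈ Finset.range (n + 1), sojourn k ω

/-- The last state `xₙ` of a history. -/
def histState (n : ℕ) (h : Hist E n) : E := stageState n (h ⟨n, Finset.mem_Iic.2 le_rfl⟩)

theorem measurable_histState (n : ℕ) : Measurable (histState (E := E) n) :=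
  (measurable_stageState n).comp (measurable_pi_apply _)

/-- The transition from `hₙ` to `(tₙ₊₁, xₙ₊₁)`, with law `Q(dt, dy | xₙ)`. -/
def step (Q : SemiMarkovKernel E E) (n : ℕ) : Kernel (Hist E n) (Stage E (ℝ≥0 × E) (n + 1)) :=
  (Q.toKernel.comap (histState n) (measurable_histState n) : Kernel (Hist E n) (ℝ≥0 × E))

instance (Q : SemiMarkovKernel E E) (n : ℕ) : IsMarkovKernel (step Q n) :=
  inferInstanceAs (IsMarkovKernel
    (Q.toKernel.comap (histState n) (measurable_histState n) : Kernel (Hist E n) (ℝ≥0 × E)))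

/-- The point mass at the initial state `x`, on the `0`-th coordinate space. -/
def initial (x : E) : Measure (Stage E (ℝ≥0 × E) 0) := Measure.dirac (α := E) x

instance (x : E) : IsProbabilityMeasure (initial x) :=
  inferInstanceAs (IsProbabilityMeasure (Measure.dirac (α := E) x))

/-- `ℙₓ`, the law of the marked point process started at `x`. -/
def law (Q : SemiMarkovKernel E E) (x : E) : Measure (Path E) :=
  Kernel.trajMeasure (X := Stage E (ℝ≥0 × E)) (initial x) (step Q)

open Classical in
/-- The continuous-time process: `X(t) = Xₙ` for `Sₙ ≤ t < Sₙ₊₁`. It is undefined (`none`) at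
times not covered by such an interval, i.e. at `t ≥ lim Sₙ` (and `t < 0`). -/
def process (ω : Path E) (t : ℝ) : Option E :=
  if h : ∃ n, (jumpTime n ω : ℝ) ≤ t ∧ t < jumpTime (n + 1) ω then
    some (state (Nat.find h) ω) else none

/-- A cost function, with cost `0` where the process is undefined. -/
def extendCost {α : Type v} (c : α → ℝ≥0) (y : Option α) : ℝ≥0∞ := y.elim 0 fun x => (c x : ℝ≥0∞)

/-- `∫₀ˢ c(X(t)) dt`. -/
def runningCost (c : E → ℝ≥0) (s : ℝ≥0) (ω : Path E) : ℝ≥0∞ :=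
  ∫⁻ t in Set.Ico (0 : ℝ) s, extendCost c (process ω t)

/-- The cost `R` paid with planning horizon `s` on `ω` when stopping at the `τ`-th jump:
running cost up to `S_τ` plus terminal cost if `S_τ < s`, running cost up to `s` otherwise
(in particular if `τ = ∞`). -/
def stoppedCost (c g : E → ℝ≥0) (s : ℝ≥0) (τ : WithTop ℕ) (ω : Path E) : ℝ≥0∞ :=
  match τ with
  | ⊤ => runningCost c s ω
  | (n : ℕ) =>
    if jumpTime n ω < s then
      runningCost c (jumpTime n ω) ω + extendCost g (process ω (jumpTime n ω))
    else runningCost c s ω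

/-- `V^τ(s, x)`, the `s`-horizon expected cost of `τ`. -/
def expectedCost (Q : SemiMarkovKernel E E) (c g : E → ℝ≥0) (τ : Path E → WithTop ℕ)
    (s : ℝ≥0) (x : E) : ℝ≥0∞ :=
  ∫⁻ ω, stoppedCost c g s (τ ω) ω ∂(law Q x)

/-- `V*(s, x)`, the infimum over all stopping times of the filtration
`𝓕ₙ = σ(T₀, X₀, …, Tₙ, Xₙ)`, which is that of the first `n + 1` coordinates. -/
def value (Q : SemiMarkovKernel E E) (c g : E → ℝ≥0) (s : ℝ≥0) (x : E) : ℝ≥0∞ :=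
  ⨅ (τ : Path E → WithTop ℕ)
    (_ : IsStoppingTime (Filtration.piLE (X := Stage E (ℝ≥0 × E))) τ), expectedCost Q c g τ s x

/-- The operator `𝔾`:
`𝔾u(s,x) = min {c(x) ∫₀ˢ (1 - Q(t,E|x)) dt + ∫_{[0,s] × E} u(s-t,y) Q(dt,dy|x), g(x)}`. -/
def bellman (Q : SemiMarkovKernel E E) (c g : E → ℝ≥0) (u : ℝ≥0 → E → ℝ≥0∞)
    (s : ℝ≥0) (x : E) : ℝ≥0∞ :=
  min
    ((c x : ℝ≥0∞) * (∫⁻ t in Set.Icc (0 : ℝ) s, (1 - Q.cdf t.toNNReal Set.univ x))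
      + ∫⁻ p in Set.Iic s ×ˢ Set.univ, u (s - p.1) p.2 ∂(Q.toKernel x))
    (g x)

/-- The value iterates `V*₀ = 0`, `V*ₙ₊₁ = 𝔾 V*ₙ`. -/
def valueIter (Q : SemiMarkovKernel E E) (c g : E → ℝ≥0) : ℕ → ℝ≥0 → E → ℝ≥0∞
  | 0 => fun _ _ => 0
  | n + 1 => bellman Q c g (valueIter Q c g n)

end SMP

/-! ### Semi-Markov decision processes with terminal cost -/

/-- A semi-Markov decision model with state space `S` and action space `A`. The data on
inadmissible state-action pairs are arbitrary and irrelevant. -/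
structure SMDP (S : Type u) (A : Type) [MeasurableSpace S] [MeasurableSpace A] where
  /-- the admissible actions `A(x)` -/
  adm : S → Set A
  adm_finite : ∀ x, (adm x).Finite
  measurableSet_adm : MeasurableSet {p : S × A | p.2 ∈ adm p.1}
  exists_selector : ∃ f : ℝ × S → A, Measurable f ∧ ∀ p, f p ∈ adm p.2
  /-- the semi-Markov kernel `Q(t, B | x, a)` -/
  Q : SemiMarkovKernel (S × A) S
  /-- the cost rate -/
  c : S × A → ℝ≥0
  measurable_c : Measurable c
  /-- the terminal cost -/
  g : S × A → ℝ≥0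
  measurable_g : Measurable g

namespace SMDP

variable {S : Type u} {A : Type} [MeasurableSpace S] [MeasurableSpace A]

/-- The sample space of all `(x₀, a₀, t₁, x₁, a₁, t₂, x₂, …)`. -/
abbrev Path (S : Type u) (A : Type) : Type u := (n : ℕ) → Stage S (A × ℝ≥0 × S) n

/-- The space of all `ĥₙ = (x₀, a₀, t₁, x₁, …, aₙ₋₁, tₙ, xₙ)`. -/
abbrev Hist (S : Type u) (A : Type) (n : ℕ) : Type u :=
  (i : Finset.Iic n) → Stage S (A × ℝ≥0 × S) i

/-- The state contained in the `n`-th entry. -/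
def stageState : (n : ℕ) → Stage S (A × ℝ≥0 × S) n → S
  | 0, x => x
  | _ + 1, p => p.2.2

/-- The sojourn time contained in the `n`-th entry (`T₀ = 0`). -/
def stageTime : (n : ℕ) → Stage S (A × ℝ≥0 × S) n → ℝ≥0
  | 0, _ => 0
  | _ + 1, p => p.2.1

theorem measurable_stageState : ∀ n, Measurable (stageState (S := S) (A := A) n)
  | 0 => measurable_id
  | _ + 1 => measurable_snd.comp measurable_snd

theorem measurable_stageTime : ∀ n, Measurable (stageTime (S := S) (A := A) n)
  | 0 => measurable_const
  | _ + 1 => measurable_fst.comp measurable_snd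

/-- `X̂ₙ`. -/
def state (n : ℕ) (ω : Path S A) : S := stageState n (ω n)

/-- `T̂ₙ`, with `T̂₀ = 0`. -/
def sojourn (n : ℕ) (ω : Path S A) : ℝ≥0 := stageTime n (ω n)

/-- `Aₙ`, the action chosen at the `n`-th decision epoch. -/
def action (n : ℕ) (ω : Path S A) : A :=
  Prod.fst (α := A) (β := ℝ≥0 × S) (ω (n + 1))

/-- `Ŝₙ = T̂₀ + ⋯ + T̂ₙ`. -/
def jumpTime (n : ℕ) (ω : Path S A) : ℝ≥0 := ∑ k ∈ Finset.range (n + 1), sojourn k ω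

/-- The last state `xₙ` of a history. -/
def histState (n : ℕ) (h : Hist S A n) : S := stageState n (h ⟨n, Finset.mem_Iic.2 le_rfl⟩)

/-- `Ŝₙ` as a function of the history: `t₁ + ⋯ + tₙ`. -/
def histTime (n : ℕ) (h : Hist S A n) : ℝ≥0 := ∑ i : Finset.Iic n, stageTime i (h i)

theorem measurable_histState (n : ℕ) : Measurable (histState (S := S) (A := A) n) :=
  (measurable_stageState n).comp (measurable_pi_apply _)

theorem measurable_histTime (n : ℕ) : Measurable (histTime (S := S) (A := A) n) :=
  Finset.measurable_sum _ fun i _ => (measurable_stageTime i).comp (measurable_pi_apply i)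

variable (M : SMDP S A)

/-- `ĥₙ` is admissible: `aₘ ∈ A(xₘ)` for all `m < n`. -/
def IsAdmissible {n : ℕ} (h : Hist S A n) : Prop :=
  ∀ (m : ℕ) (hm : m + 1 ≤ n),
    Prod.fst (α := A) (β := ℝ≥0 × S) (h ⟨m + 1, Finset.mem_Iic.2 hm⟩) ∈
      M.adm (stageState m (h ⟨m, Finset.mem_Iic.2 (by omega)⟩))

/-- A (randomized, history-dependent) policy: stochastic kernels `πₙ(· | s, ĥₙ)`, where `s` is the
remaining planning horizon, which give full mass to `A(xₙ)` on admissible histories. The values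
at inadmissible histories are arbitrary and irrelevant. -/
structure Policy where
  kernel : (n : ℕ) → Kernel (ℝ × Hist S A n) A
  isMarkov : ∀ n, IsMarkovKernel (kernel n)
  adm : ∀ (n : ℕ) (s : ℝ) (h : Hist S A n), M.IsAdmissible h →
    kernel n (s, h) (M.adm (histState n h)) = 1

attribute [instance] Policy.isMarkov

variable {M}

/-- The law of the action `aₙ` given `ĥₙ`, namely `πₙ(· | s - Ŝₙ, ĥₙ)`. -/
def Policy.actionKernel (π : M.Policy) (s : ℝ≥0) (n : ℕ) : Kernel (Hist S A n) A :=
  (π.kernel n).comap (fun h => ((s : ℝ) - histTime n h, h))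
    ((measurable_const.sub (measurable_histTime n).coe_nnreal_real).prodMk measurable_id)

instance (π : M.Policy) (s : ℝ≥0) (n : ℕ) : IsMarkovKernel (π.actionKernel s n) := by
  unfold Policy.actionKernel; infer_instance

variable (M) in
/-- The law of `(tₙ₊₁, xₙ₊₁)` given `(ĥₙ, aₙ)`, namely `Q̂(dt, dy | xₙ, aₙ)`. -/
def jumpKernel (n : ℕ) : Kernel (Hist S A n × A) (ℝ≥0 × S) :=
  M.Q.toKernel.comap (fun p => (histState n p.1, p.2))
    (((measurable_histState n).comp measurable_fst).prodMk measurable_snd)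

instance (n : ℕ) : IsMarkovKernel (M.jumpKernel n) := by
  unfold jumpKernel; infer_instance

/-- The transition from `ĥₙ` to `(aₙ, tₙ₊₁, xₙ₊₁)` under `π` with initial horizon `s`. -/
def Policy.step (π : M.Policy) (s : ℝ≥0) (n : ℕ) :
    Kernel (Hist S A n) (Stage S (A × ℝ≥0 × S) (n + 1)) :=
  (Kernel.compProd (π.actionKernel s n) (M.jumpKernel n) : Kernel (Hist S A n) (A × ℝ≥0 × S))

instance (π : M.Policy) (s : ℝ≥0) (n : ℕ) : IsMarkovKernel (π.step s n) :=
  inferInstanceAs (IsMarkovKernel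
    (Kernel.compProd (π.actionKernel s n) (M.jumpKernel n) : Kernel (Hist S A n) (A × ℝ≥0 × S)))

/-- The point mass at the initial state `x`, on the `0`-th coordinate space. -/
def initial (A : Type) [MeasurableSpace A] (x : S) : Measure (Stage S (A × ℝ≥0 × S) 0) :=
  Measure.dirac (α := S) x

instance (x : S) : IsProbabilityMeasure (initial A x) :=
  inferInstanceAs (IsProbabilityMeasure (Measure.dirac (α := S) x))

/-- The law of the decision process under `π`, with initial horizon `s` and initial state `x`. -/
def Policy.law (π : M.Policy) (s : ℝ≥0) (x : S) : Measure (Path S A) :=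
  Kernel.trajMeasure (X := Stage S (A × ℝ≥0 × S)) (initial A x) (π.step s)

open Classical in
/-- The pair `(X̂(t), A(t)) = (X̂ₙ, Aₙ)` for `Ŝₙ ≤ t < Ŝₙ₊₁`; `none` stands for the extra state
and action at times `t ≥ lim Ŝₙ`. -/
def process (ω : Path S A) (t : ℝ) : Option (S × A) :=
  if h : ∃ n, (jumpTime n ω : ℝ) ≤ t ∧ t < jumpTime (n + 1) ω then
    some (state (Nat.find h) ω, action (Nat.find h) ω) else none

/-- `U^π(s, x)`, the expectation of `∫₀ˢ ĉ(X̂(t), A(t)) dt + ĝ(X̂(s), A(s))`. -/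
def Policy.expectedCost (π : M.Policy) (s : ℝ≥0) (x : S) : ℝ≥0∞ :=
  ∫⁻ ω, ((∫⁻ t in Set.Ico (0 : ℝ) s, SMP.extendCost M.c (process ω t))
    + SMP.extendCost M.g (process ω s)) ∂(π.law s x)

variable (M) in
/-- `U*(s, x)`, the infimum over all policies. -/
def value (s : ℝ≥0) (x : S) : ℝ≥0∞ := ⨅ π : M.Policy, π.expectedCost s x

end SMDP

/-! ### The decision process of the stopping problem

States are `E ∪ {Δ}` with `Δ = Sum.inr ()`; action `0` means continue, action `1` means stop. -/

namespace StoppingSMDP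

variable {E : Type u} [MeasurableSpace E]

/-- `A(x) = {0, 1}` for `x ∈ E`, `A(Δ) = {1}`. -/
def adm : E ⊕ Unit → Set (Fin 2) := Sum.elim (fun _ => {0, 1}) (fun _ => {1})

/-- `1_{[T+1, ∞)}(t) δ_Δ(B)`, as a measure on `ℝ₊ × (E ∪ {Δ})`. -/
def stopMeasure (E : Type u) [MeasurableSpace E] (T : ℝ≥0) : Measure (ℝ≥0 × (E ⊕ Unit)) :=
  Measure.dirac (T + 1, Sum.inr ())

/-- `Q̂_T(dt, dy | x, a)`: at `x ∈ E` with `a = 0` it is `Q(dt, dy | x)` carried by `ℝ₊ × E`,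
otherwise it is `1_{[T+1, ∞)}(t) δ_Δ(B)`. -/
def transition (Q : SemiMarkovKernel E E) (T : ℝ≥0) (p : (E ⊕ Unit) × Fin 2) :
    Measure (ℝ≥0 × (E ⊕ Unit)) :=
  if p.2 = 0 then
    Sum.elim (fun x => (Q.toKernel x).map (Prod.map id Sum.inl)) (fun _ => stopMeasure E T) p.1
  else stopMeasure E T

/-- `ĉ(x, 0) = c(x)` for `x ∈ E`, and `0` otherwise. -/
def runCost (c : E → ℝ≥0) (p : (E ⊕ Unit) × Fin 2) : ℝ≥0 :=
  if p.2 = 0 then Sum.elim c (fun _ => 0) p.1 else 0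

/-- `ĝ(x, 1) = g(x)` for `x ∈ E`, and `0` otherwise. -/
def termCost (g : E → ℝ≥0) (p : (E ⊕ Unit) × Fin 2) : ℝ≥0 :=
  if p.2 = 1 then Sum.elim g (fun _ => 0) p.1 else 0

theorem measurableSet_action (a : Fin 2) :
    MeasurableSet {p : (E ⊕ Unit) × Fin 2 | p.2 = a} :=
  measurable_snd (measurableSet_singleton a)

theorem measurable_transition (Q : SemiMarkovKernel E E) (T : ℝ≥0) :
    Measurable (transition Q T) := by
  refine Measurable.ite (measurableSet_action 0) (Measurable.comp ?_ measurable_fst)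
    measurable_const
  refine Measurable.sumElim ?_ measurable_const
  exact (Measure.measurable_map _ (measurable_id.prodMap measurable_inl)).comp Q.toKernel.measurable

/-- `Q̂_T` as a semi-Markov kernel. -/
def kernel (Q : SemiMarkovKernel E E) (T : ℝ≥0) :
    SemiMarkovKernel ((E ⊕ Unit) × Fin 2) (E ⊕ Unit) where
  toKernel := ⟨transition Q T, measurable_transition Q T⟩
  isMarkov := by
    refine ⟨fun p => ?_⟩
    change IsProbabilityMeasure (transition Q T p)
    rcases p with ⟨x | y, a⟩ <;> by_cases ha : a = 0 <;>
      simp only [transition, stopMeasure, ha, if_true, if_false, Sum.elim_inl, Sum.elim_inr]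
    · exact Measure.isProbabilityMeasure_map (measurable_id.prodMap measurable_inl).aemeasurable
    all_goals infer_instance
  zero := by
    intro p
    change transition Q T p _ = 0
    have hm : MeasurableSet (({0} : Set ℝ≥0) ×ˢ (Set.univ : Set (E ⊕ Unit))) :=
      (measurableSet_singleton 0).prod MeasurableSet.univ
    have hs : stopMeasure E T (({0} : Set ℝ≥0) ×ˢ Set.univ) = 0 := by
      rw [stopMeasure, Measure.dirac_apply' _ hm]
      simp
    rcases p with ⟨x | y, a⟩ <;> by_cases ha : a = 0 <;>
      simp only [transition, ha, if_true, if_false, Sum.elim_inl, Sum.elim_inr, hs]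
    rw [Measure.map_apply (measurable_id.prodMap measurable_inl) hm]
    have : Prod.map id Sum.inl ⁻¹' (({0} : Set ℝ≥0) ×ˢ (Set.univ : Set (E ⊕ Unit)))
        = ({0} : Set ℝ≥0) ×ˢ (Set.univ : Set E) := by
      ext ⟨t, y⟩; simp
    rw [this, Q.zero]

end StoppingSMDP

/-- The semi-Markov decision process equivalent to the stopping problem with horizon `T`. -/
def stoppingSMDP {E : Type u} [MeasurableSpace E] (Q : SemiMarkovKernel E E) (T : ℝ≥0)
    (c g : E → ℝ≥0) (hc : Measurable c) (hg : Measurable g) : SMDP (E ⊕ Unit) (Fin 2) where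
  adm := StoppingSMDP.adm
  adm_finite := fun _ => Set.toFinite _
  measurableSet_adm := by
    have h : {p : (E ⊕ Unit) × Fin 2 | p.2 ∈ StoppingSMDP.adm p.1}
        = {p | p.2 = 1} ∪ (Set.range Sum.inl) ×ˢ Set.univ := by
      ext ⟨x | y, a⟩ <;> fin_cases a <;> simp [StoppingSMDP.adm]
    rw [h]
    exact (StoppingSMDP.measurableSet_action 1).union
      (measurableSet_range_inl.prod MeasurableSet.univ)
  exists_selector := ⟨fun _ => 1, measurable_const, by
    rintro ⟨t, x | y⟩ <;> simp [StoppingSMDP.adm]⟩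
  Q := StoppingSMDP.kernel Q T
  c := StoppingSMDP.runCost c
  measurable_c := Measurable.ite (StoppingSMDP.measurableSet_action 0)
    ((hc.sumElim measurable_const).comp measurable_fst) measurable_const
  g := StoppingSMDP.termCost g
  measurable_g := Measurable.ite (StoppingSMDP.measurableSet_action 1)
    ((hg.sumElim measurable_const).comp measurable_fst) measurable_const

end

/-!
Put `V = sup_n Vₙ` for the value iterates `Vₙ` (`SMP.valueLimit`). Since the expectation of
`min T₁ r` is `∫₀ʳ (1 - Q(t, E | x)) dt`, the operator `𝔾` is the minimum of the stopping cost `g`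
and of the expected cost of waiting for one jump and paying `u` afterwards (`SMP.contCost`), at
least for functions `u` that vanish at horizon `0`, as all iterates do. By monotone convergence
`V = 𝔾 V`, and everything reduces to the two identities `V* = V` and `U* = V`.

Both are proved with the filtration of the jumps rather than by shifting trajectories. The cost of a
stopping time, or of a policy, is almost surely the sum over `n` of the cost `Dₙ` incurred between
the `n`-th and the `(n+1)`-st jump; nothing is paid after an accumulation point of the jump times,
so this holds on every trajectory with positive sojourn times. The law of the next jump
given the past is the kernel that defines the process (`lintegral_trajMeasure_frestrictLe_succ`),
so the expectation of `Dₙ + u(s - Sₙ₊₁, Xₙ₊₁)` is an integral of one-step costs over the history up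
to the `n`-th jump.

* Lower bound: `E[V_{N-n}(s - Sₙ, Xₙ)] ≤ E[Dₙ] + E[V_{N-n-1}(s - Sₙ₊₁, Xₙ₊₁)]` on the event that
  the process has not been stopped. Summing over `n < N` gives `V_N ≤ ∑ E[Dₙ]`, for every stopping
  time (`SMP.valueIter_le_expectedCost`) and every policy (`SMDP.Policy.le_expectedCost`).
* Upper bound: for the rule that stops as soon as `g` does not exceed the cost of continuing, the
  analogous inequality for `V` itself is reversed, and summing over all `n` gives `∑ E[Dₙ] ≤ V`
  (`SMP.expectedCost_greedyTime_le`, `SMDP.Policy.expectedCost_le`).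

Horizons are truncated differences `s - Sₙ` in `ℝ≥0`. As `Vₙ` and `V` vanish at horizon `0`, jumps
after time `s` contribute nothing and need no separate treatment. In the decision process a stop is
followed by a sojourn of length `T + 1 > s`, so that the terminal cost is paid exactly once.
-/

/-! ### Trajectories with given transition kernels -/

/-- Given the trajectory up to time `n`, the next entry has law `κ n`. -/
theorem lintegral_trajMeasure_frestrictLe_succ {X : ℕ → Type*} [∀ n, MeasurableSpace (X n)]
    {μ₀ : Measure (X 0)} [IsProbabilityMeasure μ₀]
    {κ : (n : ℕ) → Kernel ((i : Finset.Iic n) → X i) (X (n + 1))} [∀ n, IsMarkovKernel (κ n)]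
    (n : ℕ) {f : ((i : Finset.Iic n) → X i) × X (n + 1) → ℝ≥0∞} (hf : Measurable f) :
    ∫⁻ ω, f (Preorder.frestrictLe n ω, ω (n + 1)) ∂(Kernel.trajMeasure μ₀ κ)
      = ∫⁻ ω, ∫⁻ y, f (Preorder.frestrictLe n ω, y) ∂(κ n (Preorder.frestrictLe n ω))
          ∂(Kernel.trajMeasure μ₀ κ) := by
  have h := Kernel.map_frestrictLe_trajMeasure_compProd_eq_map_trajMeasure
    (μ₀ := μ₀) (κ := κ) (a := n)
  have h2 : ∫⁻ p, f p ∂((Kernel.trajMeasure μ₀ κ).map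
      (fun x ↦ (Preorder.frestrictLe n x, x (n + 1))))
      = ∫⁻ ω, f (Preorder.frestrictLe n ω, ω (n + 1)) ∂(Kernel.trajMeasure μ₀ κ) :=
    lintegral_map hf (by fun_prop)
  rw [← h2, ← h, Measure.lintegral_compProd hf, lintegral_map]
  · exact hf.lintegral_kernel_prod_right'
  · fun_prop

theorem map_trajMeasure_zero {X : ℕ → Type*} [∀ n, MeasurableSpace (X n)]
    {μ₀ : Measure (X 0)} [IsProbabilityMeasure μ₀]
    {κ : (n : ℕ) → Kernel ((i : Finset.Iic n) → X i) (X (n + 1))} [∀ n, IsMarkovKernel (κ n)] :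
    (Kernel.trajMeasure μ₀ κ).map (fun ω => ω 0) = μ₀ := by
  have h0 : (Kernel.trajMeasure μ₀ κ).map (Preorder.frestrictLe 0)
      = μ₀.map (MeasurableEquiv.piUnique (fun i : Finset.Iic 0 => X i)).symm := by
    rw [Kernel.trajMeasure, Measure.map_comp _ _ (by fun_prop), Kernel.traj_map_frestrictLe,
      Kernel.partialTraj_self, Measure.id_comp]
    rfl
  have hm : Measurable fun h : ((i : Finset.Iic 0) → X i) => h ⟨0, Finset.mem_Iic.2 le_rfl⟩ :=
    measurable_pi_apply _
  have h1 : (Kernel.trajMeasure μ₀ κ).map (fun ω => ω 0)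
      = ((Kernel.trajMeasure μ₀ κ).map (Preorder.frestrictLe 0)).map
        (fun h => h ⟨0, Finset.mem_Iic.2 le_rfl⟩) := by
    rw [Measure.map_map hm (by fun_prop)]
    rfl
  rw [h1, h0]
  exact (Measure.map_map hm (MeasurableEquiv.measurable _)).trans Measure.map_id

/-! ### Costs of jump processes and telescoping sums -/

/-- A cost evaluated along a jump process `P` is the sum of its values on the holding intervals: at
most one summand is nonzero, and none is if the jumps have accumulated before `t`. -/
theorem extendCost_eq_tsum {γ : Type*} (c : γ → ℝ≥0) {S : ℕ → ℝ≥0} (hS : Monotone S)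
    {Z : ℕ → γ} {P : ℝ → Option γ}
    (h_some : ∀ n t, (S n : ℝ) ≤ t → t < S (n + 1) → P t = some (Z n))
    (h_none : ∀ t, (¬ ∃ n, (S n : ℝ) ≤ t ∧ t < S (n + 1)) → P t = none) (t : ℝ) :
    SMP.extendCost c (P t)
      = ∑' n, (Set.Ico (S n : ℝ) (S (n + 1))).indicator (fun _ => (c (Z n) : ℝ≥0∞)) t := by
  by_cases h : ∃ n, (S n : ℝ) ≤ t ∧ t < S (n + 1)
  · obtain ⟨n, h1, h2⟩ := h
    rw [h_some n t h1 h2, tsum_eq_single n]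
    · simp [SMP.extendCost, h1, h2]
    · intro m hm
      apply Set.indicator_of_notMem
      rintro ⟨h3, h4⟩
      rcases lt_or_gt_of_ne hm with h | h
      · have : (S (m + 1) : ℝ) ≤ S n := by exact_mod_cast hS h
        linarith
      · have : (S (n + 1) : ℝ) ≤ S m := by exact_mod_cast hS h
        linarith
  · rw [h_none t h]
    symm
    simp only [SMP.extendCost, Option.elim_none, ENNReal.tsum_eq_zero]
    intro n
    apply Set.indicator_of_notMem
    exact fun h' => h ⟨n, h'⟩

theorem lintegral_extendCost_eq_tsum {γ : Type*} (c : γ → ℝ≥0) {S : ℕ → ℝ≥0} (hS : Monotone S)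
    {Z : ℕ → γ} {P : ℝ → Option γ}
    (h_some : ∀ n t, (S n : ℝ) ≤ t → t < S (n + 1) → P t = some (Z n))
    (h_none : ∀ t, (¬ ∃ n, (S n : ℝ) ≤ t ∧ t < S (n + 1)) → P t = none) (u : ℝ≥0) :
    ∫⁻ t in Set.Ico (0 : ℝ) u, SMP.extendCost c (P t)
      = ∑' n, ((c (Z n) * (min (S (n + 1)) u - S n) : ℝ≥0) : ℝ≥0∞) := by
  simp_rw [extendCost_eq_tsum c hS h_some h_none]
  rw [lintegral_tsum fun n => (measurable_const.indicator measurableSet_Ico).aemeasurable]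
  congr 1 with n
  rw [lintegral_indicator measurableSet_Ico, lintegral_const, Measure.restrict_restrict
    measurableSet_Ico, Measure.restrict_apply_univ, Set.Ico_inter_Ico, Real.volume_Ico,
    max_eq_left (NNReal.coe_nonneg _), ENNReal.coe_mul, ← NNReal.coe_min,
    ENNReal.ofReal, NNReal.sub_def]

/-- Telescoping over finitely many stages, with nothing left to pay at stage `N`. -/
theorem le_tsum_of_le_add_succ {a w : ℕ → ℝ≥0∞} {N : ℕ} (hN : w N = 0)
    (h : ∀ n < N, w n ≤ a n + w (n + 1)) : w 0 ≤ ∑' n, a n := by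
  have h1 : ∀ n ≤ N, w 0 ≤ ∑ k ∈ Finset.range n, a k + w n := by
    intro n hn
    induction n with
    | zero => simp
    | succ n ih =>
      rw [Finset.sum_range_succ, add_assoc]
      exact (ih (by omega)).trans (add_le_add le_rfl (h n (by omega)))
  have h2 := h1 N le_rfl
  rw [hN, add_zero] at h2
  exact h2.trans (ENNReal.sum_le_tsum _)

/-- Telescoping over all stages; the remainders `w n` may be dropped since they are nonnegative. -/
theorem tsum_le_of_add_succ_le {a w : ℕ → ℝ≥0∞} (h : ∀ n, a n + w (n + 1) ≤ w n) :
    ∑' n, a n ≤ w 0 := by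
  refine ENNReal.tsum_le_of_sum_range_le fun n => ?_
  suffices ∑ k ∈ Finset.range n, a k + w n ≤ w 0 from le_self_add.trans this
  induction n with
  | zero => simp
  | succ n ih =>
    rw [Finset.sum_range_succ, add_assoc]
    exact (add_le_add le_rfl (h n)).trans ih

theorem Nat.find_eq_of_mem_Ico {S : ℕ → ℝ≥0} (hS : Monotone S) {n : ℕ} {t : ℝ}
    (h1 : (S n : ℝ) ≤ t) (h2 : t < S (n + 1))
    [DecidablePred fun n => (S n : ℝ) ≤ t ∧ t < S (n + 1)]
    (h : ∃ n, (S n : ℝ) ≤ t ∧ t < S (n + 1)) : Nat.find h = n := by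
  obtain ⟨h3, h4⟩ := Nat.find_spec h
  by_contra hne
  rcases lt_or_gt_of_ne hne with hlt | hgt
  · have : (S (Nat.find h + 1) : ℝ) ≤ S n := by exact_mod_cast hS hlt
    linarith
  · have : (S (n + 1) : ℝ) ≤ S (Nat.find h) := by exact_mod_cast hS hgt
    linarith

theorem NNReal.min_add_tsub (a b s : ℝ≥0) : min (a + b) s - a = min b (s - a) := by
  rcases le_total (a + b) s with h | h
  · rw [min_eq_left h, add_tsub_cancel_left, min_eq_left (le_tsub_of_add_le_left h)]
  · rw [min_eq_right h, min_eq_right (tsub_le_iff_left.2 h)]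

/-! ### The Bellman operator and the value iterates -/

namespace SMP

variable {E : Type*} [MeasurableSpace E]

/-- The expected cost of waiting for the first jump with remaining horizon `r`, when `u` is paid
after it: the expectation of `c(x) min(T₁, r) + u(r - T₁, X₁)`. The difference `r - T₁` is
truncated, so for `T₁ > r` the second term is `u(0, X₁)`, which vanishes in all applications. -/
noncomputable def contCost (Q : SemiMarkovKernel E E) (c : E → ℝ≥0) (u : ℝ≥0 → E → ℝ≥0∞)
    (r : ℝ≥0) (x : E) : ℝ≥0∞ :=
  ∫⁻ p, (((c x * min p.1 r : ℝ≥0) : ℝ≥0∞) + u (r - p.1) p.2) ∂(Q.toKernel x)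

theorem lintegral_min_eq_lintegral_cdf (Q : SemiMarkovKernel E E) (r : ℝ≥0) (x : E) :
    ∫⁻ p, ((min p.1 r : ℝ≥0) : ℝ≥0∞) ∂(Q.toKernel x)
      = ∫⁻ t in Set.Icc (0 : ℝ) r, (1 - Q.cdf t.toNNReal Set.univ x) := by
  have h1 : ∀ p : ℝ≥0 × E, ((min p.1 r : ℝ≥0) : ℝ≥0∞) = ENNReal.ofReal (min (p.1 : ℝ) r) := by
    intro p
    rw [← NNReal.coe_min, ENNReal.ofReal_coe_nnreal]
  simp_rw [h1]
  rw [lintegral_eq_lintegral_meas_lt _ (ae_of_all _ fun p => by positivity)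
    (by fun_prop : Measurable fun p : ℝ≥0 × E => min (p.1 : ℝ) r).aemeasurable]
  have h2 : ∀ t ∈ Set.Ioi (0 : ℝ), Q.toKernel x {p | t < min (p.1 : ℝ) r}
      = (Set.Iio (r : ℝ)).indicator (fun t => 1 - Q.cdf t.toNNReal Set.univ x) t := by
    intro t ht
    by_cases hr : t < r
    · have hm : MeasurableSet (Set.Iic t.toNNReal ×ˢ (Set.univ : Set E)) :=
        measurableSet_Iic.prod MeasurableSet.univ
      rw [Set.indicator_of_mem (Set.mem_Iio.2 hr), SemiMarkovKernel.cdf,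
        ← prob_compl_eq_one_sub hm]
      congr 1 with p
      simp only [Set.mem_ofPred_eq, lt_min_iff, hr, and_true, Set.mem_compl_iff, Set.mem_prod,
        Set.mem_Iic, Set.mem_univ, not_le]
      rw [Real.toNNReal_lt_iff_lt_coe (le_of_lt ht)]
    · rw [Set.indicator_of_notMem (by simpa using hr)]
      simp [hr]
  rw [setLIntegral_congr_fun measurableSet_Ioi h2, lintegral_indicator measurableSet_Iio,
    Measure.restrict_restrict measurableSet_Iio, Set.inter_comm, Set.Ioi_inter_Iio]
  exact setLIntegral_congr Ioo_ae_eq_Icc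

/-- For `T₁ ≥ r` the horizon after the jump is `0`, so the restriction to `[0, s] × E` in `𝔾` may be
dropped if `u` vanishes at horizon `0`. -/
theorem bellman_eq (Q : SemiMarkovKernel E E) (c g : E → ℝ≥0) {u : ℝ≥0 → E → ℝ≥0∞}
    (hu : ∀ x, u 0 x = 0) (s : ℝ≥0) (x : E) :
    bellman Q c g u s x = min (contCost Q c u s x) (g x) := by
  have hm : Measurable fun p : ℝ≥0 × E => ((min p.1 s : ℝ≥0) : ℝ≥0∞) := by fun_prop
  simp only [bellman, contCost, ENNReal.coe_mul]
  rw [lintegral_add_left (hm.const_mul _), lintegral_const_mul _ hm,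
    lintegral_min_eq_lintegral_cdf,
    ← lintegral_indicator (measurableSet_Iic.prod MeasurableSet.univ)]
  congr 3 with p
  by_cases hp : p.1 ≤ s
  · simp [Set.indicator, hp]
  · simp [Set.indicator, hp, tsub_eq_zero_of_le (le_of_not_ge hp), hu]

theorem contCost_zero (Q : SemiMarkovKernel E E) (c : E → ℝ≥0) {u : ℝ≥0 → E → ℝ≥0∞}
    (hu : ∀ x, u 0 x = 0) (x : E) : contCost Q c u 0 x = 0 := by
  simp [contCost, hu]

theorem contCost_mono (Q : SemiMarkovKernel E E) (c : E → ℝ≥0) {u v : ℝ≥0 → E → ℝ≥0∞}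
    (h : ∀ s x, u s x ≤ v s x) (s : ℝ≥0) (x : E) : contCost Q c u s x ≤ contCost Q c v s x :=
  lintegral_mono fun _ => add_le_add le_rfl (h _ _)

theorem measurable_contCost (Q : SemiMarkovKernel E E) {c : E → ℝ≥0} (hc : Measurable c)
    {u : ℝ≥0 → E → ℝ≥0∞} (hu : Measurable u.uncurry) :
    Measurable (contCost Q c u).uncurry := by
  have hF : Measurable fun z : (ℝ≥0 × E) × (ℝ≥0 × E) =>
      ((c z.1.2 * min z.2.1 z.1.1 : ℝ≥0) : ℝ≥0∞) + u.uncurry (z.1.1 - z.2.1, z.2.2) := by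
    fun_prop
  exact hF.lintegral_kernel_prod_right'
    (κ := (Q.toKernel.comap Prod.snd measurable_snd : Kernel (ℝ≥0 × E) (ℝ≥0 × E)))

theorem valueIter_zero_horizon (Q : SemiMarkovKernel E E) (c g : E → ℝ≥0) (n : ℕ) (x : E) :
    valueIter Q c g n 0 x = 0 := by
  induction n generalizing x with
  | zero => rfl
  | succ n ih => simp [valueIter, bellman_eq Q c g ih, contCost_zero Q c ih]

theorem valueIter_succ (Q : SemiMarkovKernel E E) (c g : E → ℝ≥0) (n : ℕ) (s : ℝ≥0) (x : E) :
    valueIter Q c g (n + 1) s x = min (contCost Q c (valueIter Q c g n) s x) (g x) :=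
  bellman_eq Q c g (valueIter_zero_horizon Q c g n) s x

theorem measurable_valueIter (Q : SemiMarkovKernel E E) {c g : E → ℝ≥0} (hc : Measurable c)
    (hg : Measurable g) (n : ℕ) : Measurable (valueIter Q c g n).uncurry := by
  induction n with
  | zero => exact measurable_const
  | succ n ih =>
    have : (valueIter Q c g (n + 1)).uncurry
        = fun p => min ((contCost Q c (valueIter Q c g n)).uncurry p) (g p.2) := by
      ext p
      exact valueIter_succ Q c g n p.1 p.2
    rw [this]
    exact (measurable_contCost Q hc ih).min (by fun_prop)

theorem monotone_valueIter (Q : SemiMarkovKernel E E) (c g : E → ℝ≥0) (s : ℝ≥0) (x : E) :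
    Monotone fun n => valueIter Q c g n s x := by
  refine monotone_nat_of_le_succ fun n => ?_
  induction n generalizing s x with
  | zero => exact zero_le
  | succ n ih =>
    rw [valueIter_succ, valueIter_succ]
    exact min_le_min_right _ (contCost_mono Q c ih s x)

/-- The limit of the increasing sequence of value iterates. -/
noncomputable def valueLimit (Q : SemiMarkovKernel E E) (c g : E → ℝ≥0) (s : ℝ≥0) (x : E) :
    ℝ≥0∞ :=
  ⨆ n, valueIter Q c g n s x

theorem tendsto_valueIter (Q : SemiMarkovKernel E E) (c g : E → ℝ≥0) (s : ℝ≥0) (x : E) :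
    Tendsto (fun n => valueIter Q c g n s x) atTop (𝓝 (valueLimit Q c g s x)) :=
  tendsto_atTop_iSup (monotone_valueIter Q c g s x)

theorem valueLimit_zero_horizon (Q : SemiMarkovKernel E E) (c g : E → ℝ≥0) (x : E) :
    valueLimit Q c g 0 x = 0 := by
  simp [valueLimit, valueIter_zero_horizon]

theorem measurable_valueLimit (Q : SemiMarkovKernel E E) {c g : E → ℝ≥0} (hc : Measurable c)
    (hg : Measurable g) : Measurable (valueLimit Q c g).uncurry :=
  Measurable.iSup fun n => measurable_valueIter Q hc hg n

theorem contCost_valueLimit (Q : SemiMarkovKernel E E) {c g : E → ℝ≥0} (hc : Measurable c)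
    (hg : Measurable g) (s : ℝ≥0) (x : E) :
    contCost Q c (valueLimit Q c g) s x = ⨆ n, contCost Q c (valueIter Q c g n) s x := by
  simp only [contCost, valueLimit, ENNReal.add_iSup]
  refine lintegral_iSup (fun n => ?_) fun m n hmn p =>
    add_le_add le_rfl (monotone_valueIter Q c g _ _ hmn)
  have h := measurable_valueIter Q hc hg n
  have : Measurable fun p : ℝ≥0 × E => (valueIter Q c g n).uncurry (s - p.1, p.2) := by fun_prop
  have h2 : Measurable fun p : ℝ≥0 × E => ((c x * min p.1 s : ℝ≥0) : ℝ≥0∞) := by fun_prop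
  exact h2.add this

theorem valueLimit_eq_min (Q : SemiMarkovKernel E E) {c g : E → ℝ≥0} (hc : Measurable c)
    (hg : Measurable g) (s : ℝ≥0) (x : E) :
    valueLimit Q c g s x = min (contCost Q c (valueLimit Q c g) s x) (g x) := by
  rw [contCost_valueLimit Q hc hg, valueLimit, ← sup_iSup_nat_succ]
  simp_rw [valueIter_succ]
  rw [iSup_inf_eq]
  exact sup_eq_right.2 zero_le

theorem valueLimit_eq_bellman (Q : SemiMarkovKernel E E) {c g : E → ℝ≥0} (hc : Measurable c)
    (hg : Measurable g) (s : ℝ≥0) (x : E) :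
    valueLimit Q c g s x = bellman Q c g (valueLimit Q c g) s x := by
  rw [bellman_eq Q c g (valueLimit_zero_horizon Q c g), ← valueLimit_eq_min Q hc hg]

end SMP

/-! ### Expected cost of a stopping time -/

namespace SMP

universe u
variable {E : Type u}

theorem jumpTime_zero (ω : Path E) : jumpTime 0 ω = 0 := by
  simp [jumpTime, sojourn, stageTime]

theorem jumpTime_succ (n : ℕ) (ω : Path E) :
    jumpTime (n + 1) ω = jumpTime n ω + sojourn (n + 1) ω :=
  Finset.sum_range_succ _ _

theorem monotone_jumpTime (ω : Path E) : Monotone fun n => jumpTime n ω :=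
  monotone_nat_of_le_succ fun n => by rw [jumpTime_succ]; exact le_self_add

/-- `Sₙ` as a function of the history. -/
noncomputable def histTime (n : ℕ) (h : Hist E n) : ℝ≥0 := ∑ i : Finset.Iic n, stageTime i (h i)

theorem histTime_frestrictLe (n : ℕ) (ω : Path E) :
    histTime n (Preorder.frestrictLe n ω) = jumpTime n ω := by
  rw [jumpTime, Nat.range_succ_eq_Iic]
  exact Finset.sum_coe_sort (Finset.Iic n) fun k => stageTime k (ω k)

theorem process_of_mem {ω : Path E} {n : ℕ} {t : ℝ} (h1 : (jumpTime n ω : ℝ) ≤ t)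
    (h2 : t < jumpTime (n + 1) ω) : process ω t = some (state n ω) := by
  classical
  have h : ∃ n, (jumpTime n ω : ℝ) ≤ t ∧ t < jumpTime (n + 1) ω := ⟨n, h1, h2⟩
  rw [process, dif_pos h, Nat.find_eq_of_mem_Ico (monotone_jumpTime ω) h1 h2 h]

theorem runningCost_eq_tsum (c : E → ℝ≥0) (s : ℝ≥0) (ω : Path E) :
    runningCost c s ω
      = ∑' n, ((c (state n ω) * min (sojourn (n + 1) ω) (s - jumpTime n ω) : ℝ≥0) : ℝ≥0∞) := by
  have h := lintegral_extendCost_eq_tsum c (monotone_jumpTime ω) (Z := fun n => state n ω)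
    (P := process ω) (fun _ _ h1 h2 => process_of_mem h1 h2)
    (fun _ h => dif_neg h) s
  rw [runningCost]
  simpa only [jumpTime_succ, NNReal.min_add_tsub] using h

/-- The cost incurred under `τ` from the `n`-th up to the next jump: running cost within the horizon
if `τ > n`, terminal cost if `τ = n` and `Sₙ < s`. -/
noncomputable def stageCost (c g : E → ℝ≥0) (s : ℝ≥0) (τ : Path E → WithTop ℕ) (n : ℕ)
    (ω : Path E) : ℝ≥0∞ :=
  {ω | (n : WithTop ℕ) < τ ω}.indicator
      (fun ω => ((c (state n ω) * min (sojourn (n + 1) ω) (s - jumpTime n ω) : ℝ≥0) : ℝ≥0∞)) ω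
    + {ω | τ ω = n ∧ jumpTime n ω < s}.indicator (fun ω => (g (state n ω) : ℝ≥0∞)) ω

/-- Positive sojourn times ensure that the process is in state `Xₙ` at time `Sₙ`, so that the
terminal cost is that of `Xₙ`. -/
theorem stoppedCost_eq_tsum (c g : E → ℝ≥0) (s : ℝ≥0) (τ : Path E → WithTop ℕ) (ω : Path E)
    (hω : ∀ n, 0 < sojourn (n + 1) ω) :
    stoppedCost c g s (τ ω) ω = ∑' n, stageCost c g s τ n ω := by
  simp only [stageCost, ENNReal.tsum_add]
  cases hτ : τ ω with
  | top =>
    have h2 : ∀ n : ℕ, ({ω | τ ω = n ∧ jumpTime n ω < s}.indicator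
        (fun ω => (g (state n ω) : ℝ≥0∞)) ω) = 0 := fun n =>
      Set.indicator_of_notMem (fun h => by simp [hτ] at h) _
    have h1 : ∀ n : ℕ, ω ∈ {ω | (n : WithTop ℕ) < τ ω} := fun n => by simp [hτ]
    simp only [h2, Set.indicator_of_mem (h1 _), tsum_zero, add_zero]
    exact runningCost_eq_tsum c s ω
  | coe m =>
    have hmem : ∀ n : ℕ, ω ∈ {ω | (n : WithTop ℕ) < τ ω} ↔ n < m := fun n => by
      simp [hτ]
    have hg : ∑' n : ℕ, {ω | τ ω = n ∧ jumpTime n ω < s}.indicator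
        (fun ω => (g (state n ω) : ℝ≥0∞)) ω
        = {ω | jumpTime m ω < s}.indicator (fun ω => (g (state m ω) : ℝ≥0∞)) ω := by
      rw [tsum_eq_single m]
      · by_cases h : jumpTime m ω < s <;> simp [Set.indicator, hτ, h]
      · intro n hn
        refine Set.indicator_of_notMem (fun h => hn ?_) _
        have h' : (m : WithTop ℕ) = n := hτ.symm.trans h.1
        exact_mod_cast h'.symm
    rw [hg]
    by_cases hs : jumpTime m ω < s
    · have hp : process ω (jumpTime m ω) = some (state m ω) := by
        refine process_of_mem le_rfl ?_
        rw [jumpTime_succ, NNReal.coe_lt_coe]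
        exact lt_add_of_pos_right _ (hω m)
      have hl : stoppedCost c g s (m : WithTop ℕ) ω
          = runningCost c (jumpTime m ω) ω + extendCost g (process ω (jumpTime m ω)) :=
        if_pos hs
      refine hl.trans ?_
      rw [hp, runningCost_eq_tsum, Set.indicator_of_mem (by exact hs)]
      congr 2 with n
      by_cases hn : n < m
      · have hle : jumpTime n ω + sojourn (n + 1) ω ≤ jumpTime m ω := by
          rw [← jumpTime_succ]
          exact monotone_jumpTime ω hn
        rw [Set.indicator_of_mem ((hmem n).2 hn), min_eq_left (le_tsub_of_add_le_left hle),
          min_eq_left (le_tsub_of_add_le_left (hle.trans hs.le))]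
      · rw [Set.indicator_of_notMem (fun h => hn ((hmem n).1 h)),
          tsub_eq_zero_of_le (monotone_jumpTime ω (not_lt.1 hn))]
        simp
    · have hl : stoppedCost c g s (m : WithTop ℕ) ω = runningCost c s ω := if_neg hs
      refine hl.trans ?_
      rw [runningCost_eq_tsum, Set.indicator_of_notMem (by exact hs), add_zero]
      congr 1 with n
      by_cases hn : n < m
      · rw [Set.indicator_of_mem ((hmem n).2 hn)]
      · rw [Set.indicator_of_notMem (fun h => hn ((hmem n).1 h)),
          tsub_eq_zero_of_le ((not_lt.1 hs).trans (monotone_jumpTime ω (not_lt.1 hn)))]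
        simp

variable [MeasurableSpace E]

theorem measurable_stageTime : ∀ n, Measurable (stageTime (E := E) n)
  | 0 => measurable_const
  | _ + 1 => measurable_fst

theorem measurable_histTime (n : ℕ) : Measurable (histTime (E := E) n) :=
  Finset.measurable_sum _ fun i _ => (measurable_stageTime i).comp (measurable_pi_apply i)

theorem measurable_state (n : ℕ) : Measurable (state (E := E) n) :=
  (measurable_stageState n).comp (measurable_pi_apply n)

theorem measurable_sojourn (n : ℕ) : Measurable (sojourn (E := E) n) :=
  (measurable_stageTime n).comp (measurable_pi_apply n)

theorem measurable_jumpTime (n : ℕ) : Measurable (jumpTime (E := E) n) :=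
  Finset.measurable_sum _ fun i _ => measurable_sojourn i

/-- `(Sₙ, Xₙ)` is known at the `n`-th jump. -/
theorem measurable_piLE_jumpTime_state (n : ℕ) :
    Measurable[Filtration.piLE (X := Stage E (ℝ≥0 × E)) n]
      fun ω : Path E => (jumpTime n ω, state n ω) := by
  rw [Filtration.piLE_eq_comap_frestrictLe]
  have h : (fun ω : Path E => (jumpTime n ω, state n ω))
      = (fun h : Hist E n => (histTime n h, histState n h)) ∘ Preorder.frestrictLe n := by
    ext ω
    · exact congrArg _ (histTime_frestrictLe n ω).symm
    · rfl
  rw [h]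
  exact ((measurable_histTime n).prodMk (measurable_histState n)).comp
    (comap_measurable (Preorder.frestrictLe n))

instance (Q : SemiMarkovKernel E E) (x : E) : IsProbabilityMeasure (law Q x) := by
  unfold law; infer_instance

/-- On an event known at the `n`-th jump, `(Tₙ₊₁, Xₙ₊₁)` may be integrated out with the law
`Q(dt, dy | Xₙ)`. -/
theorem setLIntegral_law_succ (Q : SemiMarkovKernel E E) (x : E) (n : ℕ) {B : Set (Path E)}
    (hB : MeasurableSet[Filtration.piLE (X := Stage E (ℝ≥0 × E)) n] B)
    {F : (ℝ≥0 × E) × (ℝ≥0 × E) → ℝ≥0∞} (hF : Measurable F) :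
    ∫⁻ ω in B, F ((jumpTime n ω, state n ω), (sojourn (n + 1) ω, state (n + 1) ω)) ∂(law Q x)
      = ∫⁻ ω in B, ∫⁻ p, F ((jumpTime n ω, state n ω), p) ∂(Q.toKernel (state n ω))
          ∂(law Q x) := by
  have hB' := Filtration.le _ n _ hB
  rw [Filtration.piLE_eq_comap_frestrictLe] at hB
  obtain ⟨B', hB'm, rfl⟩ := hB
  rw [← lintegral_indicator hB', ← lintegral_indicator hB']
  let f : Hist E n × (ℝ≥0 × E) → ℝ≥0∞ :=
    (B' ×ˢ Set.univ).indicator fun z => F ((histTime n z.1, histState n z.1), z.2)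
  have hf : Measurable f :=
    (hF.comp ((((measurable_histTime n).prodMk (measurable_histState n)).comp
      measurable_fst).prodMk measurable_snd)).indicator (hB'm.prod MeasurableSet.univ)
  have key := lintegral_trajMeasure_frestrictLe_succ (X := Stage E (ℝ≥0 × E)) (μ₀ := initial x)
    (κ := step Q) n (f := f) hf
  have hval : ∀ (ω : Path E) (p : ℝ≥0 × E), f (Preorder.frestrictLe n ω, p)
      = (Preorder.frestrictLe n ⁻¹' B').indicator
        (fun ω => F ((jumpTime n ω, state n ω), p)) ω := by
    intro ω p
    by_cases h : Preorder.frestrictLe n ω ∈ B'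
    · rw [Set.indicator_of_mem (by exact h), ← histTime_frestrictLe]
      exact Set.indicator_of_mem (Set.mk_mem_prod h (Set.mem_univ p)) _
    · rw [Set.indicator_of_notMem (by exact h)]
      exact Set.indicator_of_notMem (fun h' => h h'.1) _
  calc _ = ∫⁻ ω, f (Preorder.frestrictLe n ω, ω (n + 1)) ∂(law Q x) :=
        lintegral_congr fun ω => (hval ω (ω (n + 1))).symm
    _ = _ := key
    _ = _ := by
      refine lintegral_congr fun ω => ?_
      calc _ = ∫⁻ p, f (Preorder.frestrictLe n ω, p) ∂(Q.toKernel (state n ω)) := rfl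
        _ = _ := by
          simp_rw [hval]
          by_cases h : ω ∈ Preorder.frestrictLe (π := Stage E (ℝ≥0 × E)) n ⁻¹' B' <;> simp [h]

theorem lintegral_law_state_zero (Q : SemiMarkovKernel E E) (x : E) {f : E → ℝ≥0∞}
    (hf : Measurable f) : ∫⁻ ω, f (state 0 ω) ∂(law Q x) = f x := by
  have h := map_trajMeasure_zero (X := Stage E (ℝ≥0 × E)) (μ₀ := initial x) (κ := step Q)
  calc _ = ∫⁻ y, f y ∂((law Q x).map fun ω => ω 0) :=
        (lintegral_map (μ := law Q x) (f := f) (g := fun ω : Path E => ω 0) hf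
          (measurable_pi_apply 0)).symm
    _ = ∫⁻ y, f y ∂(Measure.dirac (α := E) x) :=
        congrArg (fun μ : Measure E => ∫⁻ y, f y ∂μ) h
    _ = f x := lintegral_dirac' x hf

theorem ae_sojourn_pos (Q : SemiMarkovKernel E E) (x : E) :
    ∀ᵐ ω ∂(law Q x), ∀ n, 0 < sojourn (n + 1) ω := by
  rw [ae_all_iff]
  intro n
  have hm : MeasurableSet (({0} : Set ℝ≥0) ×ˢ (Set.univ : Set E)) :=
    (measurableSet_singleton 0).prod MeasurableSet.univ
  have h := setLIntegral_law_succ Q x n (B := Set.univ) MeasurableSet.univ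
    (F := fun z => (({0} : Set ℝ≥0) ×ˢ (Set.univ : Set E)).indicator 1 z.2)
    ((measurable_one.indicator hm).comp measurable_snd)
  simp only [lintegral_indicator_one hm, Q.zero, lintegral_zero] at h
  rw [setLIntegral_univ, lintegral_eq_zero_iff] at h
  · filter_upwards [h] with ω hω
    by_contra h0
    simp [nonpos_iff_eq_zero.1 (not_lt.1 h0)] at hω
  · exact (measurable_one.indicator hm).comp
      ((measurable_sojourn (n + 1)).prodMk (measurable_state (n + 1)))

variable {τ : Path E → WithTop ℕ}

section

variable (hτ : IsStoppingTime (Filtration.piLE (X := Stage E (ℝ≥0 × E))) τ)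
include hτ

theorem measurable_stageCost {c g : E → ℝ≥0} (hc : Measurable c) (hg : Measurable g) (s : ℝ≥0)
    (n : ℕ) : Measurable (stageCost c g s τ n) := by
  have hS := measurable_jumpTime (E := E) n
  have hX := measurable_state (E := E) n
  have hT := measurable_sojourn (E := E) (n + 1)
  have h1 : MeasurableSet {ω | (n : WithTop ℕ) < τ ω} :=
    Filtration.le _ n _ (hτ.measurableSet_gt n)
  have h2 : MeasurableSet {ω | τ ω = n} := Filtration.le _ n _ (hτ.measurableSet_eq n)
  have h3 : MeasurableSet {ω : Path E | jumpTime n ω < s} := measurableSet_lt hS measurable_const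
  exact (Measurable.indicator (by fun_prop) h1).add
    (Measurable.indicator (by fun_prop) (h2.inter h3))

theorem expectedCost_eq_tsum (Q : SemiMarkovKernel E E) {c g : E → ℝ≥0} (hc : Measurable c)
    (hg : Measurable g) (s : ℝ≥0) (x : E) :
    expectedCost Q c g τ s x = ∑' n, ∫⁻ ω, stageCost c g s τ n ω ∂(law Q x) := by
  rw [← lintegral_tsum fun n => (measurable_stageCost hτ hc hg s n).aemeasurable]
  refine lintegral_congr_ae ?_
  filter_upwards [ae_sojourn_pos Q x] with ω hω
  exact stoppedCost_eq_tsum c g s τ ω hω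

/-- One-step expectation: if `v` is what remains to be paid after the next jump, then the history
at the `n`-th jump determines the expected cost, namely that of waiting if `τ > n` and the terminal
cost if `τ = n`. -/
theorem lintegral_stageCost_add (Q : SemiMarkovKernel E E) {c g : E → ℝ≥0} (hc : Measurable c)
    (hg : Measurable g) {v : ℝ≥0 → E → ℝ≥0∞} (hv : Measurable v.uncurry) (s : ℝ≥0) (x : E)
    (n : ℕ) :
    ∫⁻ ω, stageCost c g s τ n ω ∂(law Q x)
        + ∫⁻ ω in {ω | (n : WithTop ℕ) < τ ω},
          v (s - jumpTime (n + 1) ω) (state (n + 1) ω) ∂(law Q x)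
      = ∫⁻ ω, ({ω | (n : WithTop ℕ) < τ ω}.indicator
            (fun ω => contCost Q c v (s - jumpTime n ω) (state n ω)) ω
          + {ω | τ ω = n ∧ jumpTime n ω < s}.indicator (fun ω => (g (state n ω) : ℝ≥0∞)) ω)
          ∂(law Q x) := by
  have hS := measurable_jumpTime (E := E) n
  have hX := measurable_state (E := E) n
  have hT := measurable_sojourn (E := E) (n + 1)
  have h1 := hτ.measurableSet_gt n
  have h1' : MeasurableSet {ω | (n : WithTop ℕ) < τ ω} := Filtration.le _ n _ h1
  have h2 : MeasurableSet {ω | τ ω = n} := Filtration.le _ n _ (hτ.measurableSet_eq n)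
  have h3 : MeasurableSet {ω : Path E | jumpTime n ω < s} := measurableSet_lt hS measurable_const
  have hG : Measurable ({ω | τ ω = n ∧ jumpTime n ω < s}.indicator
      (fun ω : Path E => (g (state n ω) : ℝ≥0∞))) :=
    Measurable.indicator (by fun_prop) (h2.inter h3)
  have hR : Measurable fun ω : Path E =>
      ((c (state n ω) * min (sojourn (n + 1) ω) (s - jumpTime n ω) : ℝ≥0) : ℝ≥0∞) := by
    fun_prop
  have hF : Measurable fun z : (ℝ≥0 × E) × (ℝ≥0 × E) =>
      ((c z.1.2 * min z.2.1 (s - z.1.1) : ℝ≥0) : ℝ≥0∞)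
        + v.uncurry (s - z.1.1 - z.2.1, z.2.2) := by fun_prop
  have hstep := setLIntegral_law_succ Q x n h1 hF
  simp only [stageCost]
  rw [lintegral_add_right _ hG, lintegral_add_right _ hG, lintegral_indicator h1',
    lintegral_indicator h1', add_right_comm, ← lintegral_add_left hR]
  congr 1
  calc _ = _ := by
        refine lintegral_congr fun ω => ?_
        rw [jumpTime_succ, ← tsub_tsub]
        rfl
    _ = _ := hstep

theorem valueIter_le_expectedCost (Q : SemiMarkovKernel E E) {c g : E → ℝ≥0} (hc : Measurable c)
    (hg : Measurable g) (N : ℕ) (s : ℝ≥0) (x : E) :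
    valueIter Q c g N s x ≤ expectedCost Q c g τ s x := by
  rw [expectedCost_eq_tsum hτ Q hc hg]
  have h0 : ∫⁻ ω in {ω | ((0 : ℕ) : WithTop ℕ) ≤ τ ω},
      valueIter Q c g (N - 0) (s - jumpTime 0 ω) (state 0 ω) ∂(law Q x)
      = valueIter Q c g N s x := by
    have hm := measurable_valueIter Q hc hg N
    simp only [jumpTime_zero, tsub_zero, Nat.cast_zero, zero_le]
    rw [← lintegral_law_state_zero Q x (f := valueIter Q c g N s) (by fun_prop)]
    simp
  rw [← h0]
  -- `w n` is the optimal cost from the `n`-th jump on when nothing is paid after the `N`-th one.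
  refine le_tsum_of_le_add_succ (N := N) (w := fun n => ∫⁻ ω in {ω | (n : WithTop ℕ) ≤ τ ω},
    valueIter Q c g (N - n) (s - jumpTime n ω) (state n ω) ∂(law Q x)) ?_ fun n hn => ?_
  · simp [valueIter]
  have hset : {ω | ((n + 1 : ℕ) : WithTop ℕ) ≤ τ ω} = {ω | (n : WithTop ℕ) < τ ω} := by
    ext ω
    exact ENat.add_one_le_iff (ENat.natCast_ne_top n)
  have hge : MeasurableSet {ω | (n : WithTop ℕ) ≤ τ ω} :=
    Filtration.le _ n _ (hτ.measurableSet_ge n)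
  obtain ⟨m, rfl⟩ : ∃ m, N = n + 1 + m := ⟨N - (n + 1), by omega⟩
  simp only [hset, show n + 1 + m - n = m + 1 by omega, show n + 1 + m - (n + 1) = m by omega]
  rw [lintegral_stageCost_add hτ Q hc hg (measurable_valueIter Q hc hg m),
    ← lintegral_indicator hge]
  refine lintegral_mono fun ω => ?_
  refine Set.indicator_apply_le' (fun h => ?_) fun _ => zero_le
  rcases (show (n : WithTop ℕ) ≤ τ ω from h).lt_or_eq with h | h
  · rw [valueIter_succ, Set.indicator_of_mem (by exact h)]
    exact (min_le_left _ _).trans le_self_add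
  -- Stopping at or after the horizon is free, but then the value is `0` too.
  · by_cases hs : jumpTime n ω < s
    · have hmem : ω ∈ {ω | τ ω = n ∧ jumpTime n ω < s} := ⟨h.symm, hs⟩
      rw [valueIter_succ, Set.indicator_of_mem hmem]
      exact (min_le_right _ _).trans le_add_self
    · rw [tsub_eq_zero_of_le (not_lt.1 hs), valueIter_zero_horizon]
      exact zero_le

end

/-! ### The greedy stopping time -/

open Classical in
/-- Stop at the first jump before the horizon at which the terminal cost does not exceed the
expected cost of waiting for one more jump. -/
noncomputable def greedyTime (Q : SemiMarkovKernel E E) (c g : E → ℝ≥0) (s : ℝ≥0) (ω : Path E) :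
    WithTop ℕ :=
  if h : ∃ n, jumpTime n ω < s ∧
      (g (state n ω) : ℝ≥0∞) ≤ contCost Q c (valueLimit Q c g) (s - jumpTime n ω) (state n ω)
    then (Nat.find h : ℕ) else ⊤

theorem isStoppingTime_greedyTime (Q : SemiMarkovKernel E E) {c g : E → ℝ≥0}
    (hc : Measurable c) (hg : Measurable g) (s : ℝ≥0) :
    IsStoppingTime (Filtration.piLE (X := Stage E (ℝ≥0 × E))) (greedyTime Q c g s) := by
  classical
  intro i
  have hC := measurable_contCost Q hc (measurable_valueLimit Q hc hg)
  have hset : {ω | greedyTime Q c g s ω ≤ i} = ⋃ n ≤ i, {ω | jumpTime n ω < s ∧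
      (g (state n ω) : ℝ≥0∞)
        ≤ contCost Q c (valueLimit Q c g) (s - jumpTime n ω) (state n ω)} := by
    ext ω
    simp only [Set.mem_ofPred_eq, Set.mem_iUnion, exists_prop]
    rw [greedyTime]
    split_ifs with h
    · rw [Nat.cast_le, Nat.find_le_iff]
    · refine iff_of_false (fun h' => ENat.natCast_ne_top i (top_le_iff.1 h')) ?_
      rintro ⟨n, -, hn⟩
      exact h ⟨n, hn⟩
  suffices h : MeasurableSet[Filtration.piLE (X := Stage E (ℝ≥0 × E)) i]
      {ω | greedyTime Q c g s ω ≤ (i : WithTop ℕ)} from h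
  rw [hset]
  refine MeasurableSet.iUnion fun n => MeasurableSet.iUnion fun hn => ?_
  refine Filtration.mono _ hn _ ?_
  have h1 : Measurable fun p : ℝ≥0 × E => (g p.2 : ℝ≥0∞) := by fun_prop
  have h2 : Measurable fun p : ℝ≥0 × E =>
      (contCost Q c (valueLimit Q c g)).uncurry (s - p.1, p.2) := by fun_prop
  have hB : MeasurableSet {p : ℝ≥0 × E | p.1 < s ∧
      (g p.2 : ℝ≥0∞) ≤ (contCost Q c (valueLimit Q c g)).uncurry (s - p.1, p.2)} :=
    (measurableSet_lt measurable_fst measurable_const).inter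
      (measurableSet_le h1 h2)
  exact measurable_piLE_jumpTime_state n hB

theorem expectedCost_greedyTime_le (Q : SemiMarkovKernel E E) {c g : E → ℝ≥0}
    (hc : Measurable c) (hg : Measurable g) (s : ℝ≥0) (x : E) :
    expectedCost Q c g (greedyTime Q c g s) s x ≤ valueLimit Q c g s x := by
  classical
  set τ := greedyTime Q c g s with hτ_def
  have hτ := isStoppingTime_greedyTime Q hc hg s
  have hV := measurable_valueLimit Q hc hg
  rw [expectedCost_eq_tsum hτ Q hc hg]
  have h0 : ∫⁻ ω in {ω | ((0 : ℕ) : WithTop ℕ) ≤ τ ω},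
      valueLimit Q c g (s - jumpTime 0 ω) (state 0 ω) ∂(law Q x) = valueLimit Q c g s x := by
    simp only [jumpTime_zero, tsub_zero, Nat.cast_zero, zero_le]
    rw [← lintegral_law_state_zero Q x (f := valueLimit Q c g s) (by fun_prop)]
    simp
  rw [← h0]
  refine tsum_le_of_add_succ_le (w := fun n => ∫⁻ ω in {ω | (n : WithTop ℕ) ≤ τ ω},
    valueLimit Q c g (s - jumpTime n ω) (state n ω) ∂(law Q x)) fun n => ?_
  have hset : {ω | ((n + 1 : ℕ) : WithTop ℕ) ≤ τ ω} = {ω | (n : WithTop ℕ) < τ ω} := by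
    ext ω
    exact ENat.add_one_le_iff (ENat.natCast_ne_top n)
  have hge : MeasurableSet {ω | (n : WithTop ℕ) ≤ τ ω} :=
    Filtration.le _ n _ (hτ.measurableSet_ge n)
  simp only [hset]
  rw [lintegral_stageCost_add hτ Q hc hg hV, ← lintegral_indicator hge]
  refine lintegral_mono fun ω => ?_
  -- Before `τ` the value equals the cost of waiting, at `τ` it equals the terminal cost.
  rcases lt_trichotomy (n : WithTop ℕ) (τ ω) with h | h | h
  · have h1 : ω ∉ {ω | τ ω = n ∧ jumpTime n ω < s} := fun h' => h.ne' h'.1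
    rw [Set.indicator_of_mem (by exact h), Set.indicator_of_notMem h1, add_zero,
      Set.indicator_of_mem (by exact h.le)]
    have hnot : ¬ (jumpTime n ω < s ∧ (g (state n ω) : ℝ≥0∞)
        ≤ contCost Q c (valueLimit Q c g) (s - jumpTime n ω) (state n ω)) := by
      intro hn
      have hex : ∃ n, jumpTime n ω < s ∧ (g (state n ω) : ℝ≥0∞)
        ≤ contCost Q c (valueLimit Q c g) (s - jumpTime n ω) (state n ω) := ⟨n, hn⟩
      rw [hτ_def, greedyTime, dif_pos hex, Nat.cast_lt] at h
      exact Nat.find_min hex h hn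
    by_cases hs : jumpTime n ω < s
    · rw [valueLimit_eq_min Q hc hg]
      exact le_min le_rfl (not_le.1 fun h' => hnot ⟨hs, h'⟩).le
    · rw [tsub_eq_zero_of_le (not_lt.1 hs), contCost_zero Q c (valueLimit_zero_horizon Q c g)]
      exact zero_le
  · have h1 : ω ∉ {ω | (n : WithTop ℕ) < τ ω} := fun h' => h.not_lt h'
    have h2 : ω ∈ {ω | (n : WithTop ℕ) ≤ τ ω} := h.le
    rw [Set.indicator_of_notMem h1, zero_add, Set.indicator_of_mem h2]
    have h_le_wait : (g (state n ω) : ℝ≥0∞)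
        ≤ contCost Q c (valueLimit Q c g) (s - jumpTime n ω) (state n ω) := by
      have hex : ∃ n, jumpTime n ω < s ∧ (g (state n ω) : ℝ≥0∞)
          ≤ contCost Q c (valueLimit Q c g) (s - jumpTime n ω) (state n ω) := by
        by_contra hex
        rw [hτ_def, greedyTime, dif_neg hex] at h
        exact ENat.natCast_ne_top n h
      have hfind := Nat.find_spec hex
      rw [hτ_def, greedyTime, dif_pos hex, Nat.cast_inj] at h
      rw [← h] at hfind
      exact hfind.2
    rw [valueLimit_eq_min Q hc hg]
    exact Set.indicator_le' (fun _ _ => le_min h_le_wait le_rfl) (fun _ _ => zero_le) ω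
  · have h1 : ω ∉ {ω | (n : WithTop ℕ) < τ ω} := fun h' => h.not_gt h'
    have h2 : ω ∉ {ω | τ ω = n ∧ jumpTime n ω < s} := fun h' => h.ne h'.1
    rw [Set.indicator_of_notMem h1, Set.indicator_of_notMem h2, zero_add]
    exact zero_le

theorem value_eq_valueLimit (Q : SemiMarkovKernel E E) {c g : E → ℝ≥0}
    (hc : Measurable c) (hg : Measurable g) (s : ℝ≥0) (x : E) :
    value Q c g s x = valueLimit Q c g s x :=
  le_antisymm
    (iInf₂_le_of_le _ (isStoppingTime_greedyTime Q hc hg s)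
      (expectedCost_greedyTime_le Q hc hg s x))
    (le_iInf₂ fun _ hτ => iSup_le fun N => valueIter_le_expectedCost hτ Q hc hg N s x)

end SMP

/-! ### Expected cost of a policy -/

namespace SMDP

universe u
variable {S : Type u} {A : Type}

theorem jumpTime_zero (ω : Path S A) : jumpTime 0 ω = 0 := by
  simp [jumpTime, sojourn, stageTime]

theorem jumpTime_succ (n : ℕ) (ω : Path S A) :
    jumpTime (n + 1) ω = jumpTime n ω + sojourn (n + 1) ω :=
  Finset.sum_range_succ _ _

theorem monotone_jumpTime (ω : Path S A) : Monotone fun n => jumpTime n ω :=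
  monotone_nat_of_le_succ fun n => by rw [jumpTime_succ]; exact le_self_add

theorem histTime_frestrictLe (n : ℕ) (ω : Path S A) :
    histTime n (Preorder.frestrictLe n ω) = jumpTime n ω := by
  rw [jumpTime, Nat.range_succ_eq_Iic]
  exact Finset.sum_coe_sort (Finset.Iic n) fun k => stageTime k (ω k)

theorem process_of_mem {ω : Path S A} {n : ℕ} {t : ℝ} (h1 : (jumpTime n ω : ℝ) ≤ t)
    (h2 : t < jumpTime (n + 1) ω) : process ω t = some (state n ω, action n ω) := by
  classical
  have h : ∃ n, (jumpTime n ω : ℝ) ≤ t ∧ t < jumpTime (n + 1) ω := ⟨n, h1, h2⟩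
  rw [process, dif_pos h, Nat.find_eq_of_mem_Ico (monotone_jumpTime ω) h1 h2 h]

variable [MeasurableSpace S] [MeasurableSpace A]

theorem measurable_state (n : ℕ) : Measurable (state (S := S) (A := A) n) :=
  (measurable_stageState n).comp (measurable_pi_apply n)

theorem measurable_sojourn (n : ℕ) : Measurable (sojourn (S := S) (A := A) n) :=
  (measurable_stageTime n).comp (measurable_pi_apply n)

theorem measurable_jumpTime (n : ℕ) : Measurable (jumpTime (S := S) (A := A) n) :=
  Finset.measurable_sum _ fun i _ => measurable_sojourn i

theorem measurable_action (n : ℕ) : Measurable (action (S := S) (A := A) n) :=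
  (measurable_fst (α := A) (β := ℝ≥0 × S)).comp (measurable_pi_apply (n + 1))

/-- The cost incurred between two jumps with planning horizon `s`, when the first jump takes place
at time `σ` into state `x`, action `a` is chosen and the sojourn time is `t`. The terminal cost is
due if the sojourn contains the time `s`. -/
noncomputable def stageCost (M : SMDP S A) (s σ : ℝ≥0) (x : S) (a : A) (t : ℝ≥0) : ℝ≥0∞ :=
  ((M.c (x, a) * min t (s - σ) : ℝ≥0) : ℝ≥0∞)
    + if σ ≤ s ∧ s < σ + t then (M.g (x, a) : ℝ≥0∞) else 0

theorem measurable_stageCost (M : SMDP S A) (s : ℝ≥0) :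
    Measurable fun z : (ℝ≥0 × S) × (A × ℝ≥0 × S) => M.stageCost s z.1.1 z.1.2 z.2.1 z.2.2.1 := by
  have hc := M.measurable_c
  have hg := M.measurable_g
  have h1 : Measurable fun z : (ℝ≥0 × S) × (A × ℝ≥0 × S) =>
      ((M.c (z.1.2, z.2.1) * min z.2.2.1 (s - z.1.1) : ℝ≥0) : ℝ≥0∞) := by fun_prop
  have h2 : Measurable fun z : (ℝ≥0 × S) × (A × ℝ≥0 × S) => (M.g (z.1.2, z.2.1) : ℝ≥0∞) := by
    fun_prop
  refine h1.add (h2.ite ?_ measurable_const)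
  have h3 : Measurable fun z : (ℝ≥0 × S) × (A × ℝ≥0 × S) => z.1.1 := by fun_prop
  have h4 : Measurable fun z : (ℝ≥0 × S) × (A × ℝ≥0 × S) => z.1.1 + z.2.2.1 := by fun_prop
  have h5 : MeasurableSet {z : (ℝ≥0 × S) × (A × ℝ≥0 × S) | s < z.1.1 + z.2.2.1} :=
    measurableSet_lt measurable_const h4
  exact (measurableSet_le h3 measurable_const).inter h5

theorem cost_eq_tsum (M : SMDP S A) (s : ℝ≥0) (ω : Path S A) :
    (∫⁻ t in Set.Ico (0 : ℝ) s, SMP.extendCost M.c (process ω t))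
        + SMP.extendCost M.g (process ω s)
      = ∑' n, M.stageCost s (jumpTime n ω) (state n ω) (action n ω) (sojourn (n + 1) ω) := by
  have hs : ∀ n t, (jumpTime n ω : ℝ) ≤ t → t < jumpTime (n + 1) ω
      → process ω t = some (state n ω, action n ω) := fun _ _ h1 h2 => process_of_mem h1 h2
  have hn : ∀ t, (¬ ∃ n, (jumpTime n ω : ℝ) ≤ t ∧ t < jumpTime (n + 1) ω)
      → process ω t = none := fun _ h => dif_neg h
  rw [lintegral_extendCost_eq_tsum M.c (monotone_jumpTime ω) hs hn,
    extendCost_eq_tsum M.g (monotone_jumpTime ω) hs hn, ← ENNReal.tsum_add]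
  congr 1 with n
  simp only [stageCost, jumpTime_succ, NNReal.min_add_tsub, Set.indicator, Set.mem_Ico,
    NNReal.coe_le_coe, NNReal.coe_lt_coe]

variable {M : SMDP S A}

instance (π : M.Policy) (s : ℝ≥0) (x : S) : IsProbabilityMeasure (π.law s x) := by
  unfold Policy.law; infer_instance

/-- Given the history at the `n`-th jump, the action has law `πₙ`, and `(Tₙ₊₁, Xₙ₊₁)` has law
`Q(dt, dy | Xₙ, Aₙ)` given the action. -/
theorem Policy.lintegral_law_succ (π : M.Policy) (s : ℝ≥0) (x : S) (n : ℕ)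
    {F : (ℝ≥0 × S) × (A × ℝ≥0 × S) → ℝ≥0∞} (hF : Measurable F) :
    ∫⁻ ω, F ((jumpTime n ω, state n ω), (action n ω, sojourn (n + 1) ω, state (n + 1) ω))
        ∂(π.law s x)
      = ∫⁻ ω, ∫⁻ a, ∫⁻ p, F ((jumpTime n ω, state n ω), (a, p)) ∂(M.Q.toKernel (state n ω, a))
          ∂(π.actionKernel s n (Preorder.frestrictLe n ω)) ∂(π.law s x) := by
  let f : Hist S A n × (A × ℝ≥0 × S) → ℝ≥0∞ := fun z => F ((histTime n z.1, histState n z.1), z.2)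
  have hf : Measurable f :=
    hF.comp ((((measurable_histTime n).prodMk (measurable_histState n)).comp
      measurable_fst).prodMk measurable_snd)
  have key := lintegral_trajMeasure_frestrictLe_succ (X := Stage S (A × ℝ≥0 × S))
    (μ₀ := initial A x) (κ := π.step s) n (f := f) hf
  calc _ = ∫⁻ ω, f (Preorder.frestrictLe n ω, ω (n + 1)) ∂(π.law s x) :=
        lintegral_congr fun ω => by rw [← histTime_frestrictLe]; rfl
    _ = _ := key
    _ = _ := by
      refine lintegral_congr fun ω => ?_
      refine Eq.trans (Kernel.lintegral_compProd (π.actionKernel s n) (M.jumpKernel n)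
        (Preorder.frestrictLe n ω) (hf.comp measurable_prodMk_left)) ?_
      rw [← histTime_frestrictLe]
      rfl

theorem Policy.lintegral_law_state_zero (π : M.Policy) (s : ℝ≥0) (x : S) {f : S → ℝ≥0∞}
    (hf : Measurable f) : ∫⁻ ω, f (state 0 ω) ∂(π.law s x) = f x := by
  have h := map_trajMeasure_zero (X := Stage S (A × ℝ≥0 × S)) (μ₀ := initial A x)
    (κ := π.step s)
  calc _ = ∫⁻ y, f y ∂((π.law s x).map fun ω => ω 0) :=
        (lintegral_map (μ := π.law s x) (f := f) (g := fun ω : Path S A => ω 0) hf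
          (measurable_pi_apply 0)).symm
    _ = ∫⁻ y, f y ∂(Measure.dirac (α := S) x) :=
        congrArg (fun μ : Measure S => ∫⁻ y, f y ∂μ) h
    _ = f x := lintegral_dirac' x hf

theorem Policy.expectedCost_eq_tsum (π : M.Policy) (s : ℝ≥0) (x : S) :
    π.expectedCost s x = ∑' n, ∫⁻ ω, M.stageCost s (jumpTime n ω) (state n ω) (action n ω)
      (sojourn (n + 1) ω) ∂(π.law s x) := by
  rw [← lintegral_tsum fun n => ?_]
  · exact lintegral_congr fun ω => M.cost_eq_tsum s ω
  · exact ((M.measurable_stageCost s).comp (((measurable_jumpTime n).prodMk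
      (measurable_state n)).prodMk ((measurable_action n).prodMk
        ((measurable_sojourn (n + 1)).prodMk (measurable_state (n + 1)))))).aemeasurable

variable (M) in
/-- The expected cost of action `a` in state `x` at time `σ`, when `v` remains to be paid after the
next jump. -/
noncomputable def actionCost (v : ℝ≥0 → S → ℝ≥0∞) (s σ : ℝ≥0) (x : S) (a : A) : ℝ≥0∞ :=
  ∫⁻ p, (M.stageCost s σ x a p.1 + v (s - σ - p.1) p.2) ∂(M.Q.toKernel (x, a))

theorem measurable_stageCost_add (M : SMDP S A) {v : ℝ≥0 → S → ℝ≥0∞}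
    (hv : Measurable v.uncurry) (s : ℝ≥0) :
    Measurable fun z : (ℝ≥0 × S) × (A × ℝ≥0 × S) =>
      M.stageCost s z.1.1 z.1.2 z.2.1 z.2.2.1 + v (s - z.1.1 - z.2.2.1) z.2.2.2 := by
  have h : Measurable fun z : (ℝ≥0 × S) × (A × ℝ≥0 × S) =>
      v.uncurry (s - z.1.1 - z.2.2.1, z.2.2.2) := by fun_prop
  exact (M.measurable_stageCost s).add h

theorem Policy.lintegral_stageCost_add (π : M.Policy) {v : ℝ≥0 → S → ℝ≥0∞}
    (hv : Measurable v.uncurry) (s : ℝ≥0) (x : S) (n : ℕ) :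
    ∫⁻ ω, M.stageCost s (jumpTime n ω) (state n ω) (action n ω) (sojourn (n + 1) ω) ∂(π.law s x)
        + ∫⁻ ω, v (s - jumpTime (n + 1) ω) (state (n + 1) ω) ∂(π.law s x)
      = ∫⁻ ω, ∫⁻ a, M.actionCost v s (jumpTime n ω) (state n ω) a
          ∂(π.actionKernel s n (Preorder.frestrictLe n ω)) ∂(π.law s x) := by
  have hv' : Measurable fun ω : Path S A => v (s - jumpTime (n + 1) ω) (state (n + 1) ω) :=
    hv.comp ((measurable_const.sub (measurable_jumpTime (n + 1))).prodMk
      (measurable_state (n + 1)))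
  rw [← lintegral_add_right _ hv']
  calc _ = _ := by
        refine lintegral_congr fun ω => ?_
        rw [jumpTime_succ, ← tsub_tsub]
    _ = _ := π.lintegral_law_succ s x n (M.measurable_stageCost_add hv s)

/-- Verification from below: if no action beats `v (n + 1)` with remaining cost `v n`, starting from
`v 0 = 0`, then each `v N` is a lower bound for the cost of every policy. -/
theorem Policy.le_expectedCost (π : M.Policy) {v : ℕ → ℝ≥0 → S → ℝ≥0∞}
    (hv : ∀ n, Measurable (v n).uncurry) (hv0 : ∀ r x, v 0 r x = 0) {s : ℝ≥0}
    (h : ∀ n σ x a, v (n + 1) (s - σ) x ≤ M.actionCost (v n) s σ x a) (N : ℕ) (x : S) :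
    v N s x ≤ π.expectedCost s x := by
  rw [π.expectedCost_eq_tsum]
  have h0 : ∫⁻ ω, v (N - 0) (s - jumpTime 0 ω) (state 0 ω) ∂(π.law s x) = v N s x := by
    simp only [jumpTime_zero, tsub_zero]
    exact π.lintegral_law_state_zero s x (f := v N s) ((hv N).comp measurable_prodMk_left)
  rw [← h0]
  refine le_tsum_of_le_add_succ (N := N) (w := fun n =>
    ∫⁻ ω, v (N - n) (s - jumpTime n ω) (state n ω) ∂(π.law s x)) (by simp [hv0]) fun n hn => ?_
  obtain ⟨m, rfl⟩ : ∃ m, N = n + 1 + m := ⟨N - (n + 1), by omega⟩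
  simp only [show n + 1 + m - n = m + 1 by omega, show n + 1 + m - (n + 1) = m by omega]
  rw [π.lintegral_stageCost_add (hv m)]
  refine lintegral_mono fun ω => ?_
  calc _ = ∫⁻ _, v (m + 1) (s - jumpTime n ω) (state n ω)
          ∂(π.actionKernel s n (Preorder.frestrictLe n ω)) := by simp
    _ ≤ _ := lintegral_mono fun a => h m _ _ a

/-- Verification from above: if each stage under `π` costs at most the decrease of `v`, then `v`
bounds the cost of `π`. Nonnegativity of `v` makes a condition at infinity unnecessary. -/
theorem Policy.expectedCost_le (π : M.Policy) {v : ℝ≥0 → S → ℝ≥0∞}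
    (hv : Measurable v.uncurry) {s : ℝ≥0}
    (h : ∀ n (ω : Path S A), ∫⁻ a, M.actionCost v s (jumpTime n ω) (state n ω) a
      ∂(π.actionKernel s n (Preorder.frestrictLe n ω)) ≤ v (s - jumpTime n ω) (state n ω))
    (x : S) : π.expectedCost s x ≤ v s x := by
  rw [π.expectedCost_eq_tsum]
  have h0 : ∫⁻ ω, v (s - jumpTime 0 ω) (state 0 ω) ∂(π.law s x) = v s x := by
    simp only [jumpTime_zero, tsub_zero]
    exact π.lintegral_law_state_zero s x (f := v s) (hv.comp measurable_prodMk_left)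
  rw [← h0]
  refine tsum_le_of_add_succ_le (w := fun n =>
    ∫⁻ ω, v (s - jumpTime n ω) (state n ω) ∂(π.law s x)) fun n => ?_
  rw [π.lintegral_stageCost_add hv]
  exact lintegral_mono fun ω => h n ω

variable (M) in
/-- The deterministic policy that applies `f` to the remaining horizon and the current state. -/
noncomputable def Policy.ofSelector (f : ℝ × S → A) (hf : Measurable f)
    (hadm : ∀ p, f p ∈ M.adm p.2) : M.Policy where
  kernel n := Kernel.deterministic (fun z => f (z.1, histState n z.2))
    (hf.comp (measurable_fst.prodMk ((measurable_histState n).comp measurable_snd)))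
  isMarkov n := inferInstance
  adm n s h _ := by
    rw [Kernel.deterministic_apply]
    exact Measure.dirac_apply_of_mem (hadm (s, histState n h))

theorem Policy.lintegral_actionKernel_ofSelector [MeasurableSingletonClass A] {f : ℝ × S → A}
    (hf : Measurable f) (hadm : ∀ p, f p ∈ M.adm p.2) (s : ℝ≥0) (n : ℕ) (ω : Path S A)
    (F : A → ℝ≥0∞) :
    ∫⁻ a, F a ∂((Policy.ofSelector M f hf hadm).actionKernel s n (Preorder.frestrictLe n ω))
      = F (f ((s : ℝ) - jumpTime n ω, state n ω)) := by
  rw [← histTime_frestrictLe]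
  exact lintegral_dirac _ F

end SMDP

/-! ### The decision process of the stopping problem -/

namespace StoppingSMDP

universe u
variable {E : Type u} [MeasurableSpace E]

/-- Extension of a value function to `E ∪ {Δ}` by `0` at `Δ`. -/
def extendZero (v : ℝ≥0 → E → ℝ≥0∞) (r : ℝ≥0) : E ⊕ Unit → ℝ≥0∞ := Sum.elim (v r) fun _ => 0

theorem measurable_sumElim_snd {α γ : Type*} [MeasurableSpace α] [MeasurableSpace γ]
    {f : α × E → γ} (hf : Measurable f) (k : γ) :
    Measurable fun p : α × (E ⊕ Unit) => Sum.elim (fun y => f (p.1, y)) (fun _ => k) p.2 := by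
  have h : Measurable ((Sum.elim f fun _ => k : (α × E) ⊕ (α × Unit) → γ) ∘
      MeasurableEquiv.prodSumDistrib α E Unit) :=
    (hf.sumElim measurable_const).comp (MeasurableEquiv.measurable _)
  convert h using 1
  ext ⟨r, x | y⟩ <;> rfl

theorem measurable_extendZero {v : ℝ≥0 → E → ℝ≥0∞} (hv : Measurable v.uncurry) :
    Measurable (extendZero v).uncurry :=
  measurable_sumElim_snd hv 0

variable (Q : SemiMarkovKernel E E) (T : ℝ≥0) {c g : E → ℝ≥0} (hc : Measurable c)
  (hg : Measurable g)

/-- The jump to `Δ` at time `σ + T + 1` leaves nothing to be paid. -/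
theorem actionCost_eq_of_stop {v : ℝ≥0 → E → ℝ≥0∞} (hv : Measurable v.uncurry) (s σ : ℝ≥0)
    (x : E ⊕ Unit) (a : Fin 2) (h : transition Q T (x, a) = stopMeasure E T) :
    (stoppingSMDP Q T c g hc hg).actionCost (extendZero v) s σ x a
      = (stoppingSMDP Q T c g hc hg).stageCost s σ x a (T + 1) := by
  have hm : Measurable fun p : ℝ≥0 × (E ⊕ Unit) =>
      (stoppingSMDP Q T c g hc hg).stageCost s σ x a p.1 + extendZero v (s - σ - p.1) p.2 :=
    ((stoppingSMDP Q T c g hc hg).measurable_stageCost_add (measurable_extendZero hv) s).comp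
      (f := fun p => ((σ, x), (a, p))) (by fun_prop)
  have h1 : (stoppingSMDP Q T c g hc hg).actionCost (extendZero v) s σ x a
      = ∫⁻ p, ((stoppingSMDP Q T c g hc hg).stageCost s σ x a p.1
          + extendZero v (s - σ - p.1) p.2) ∂(transition Q T (x, a)) := rfl
  rw [h1, h, stopMeasure, lintegral_dirac' _ hm]
  exact add_zero _

theorem actionCost_cemetery {v : ℝ≥0 → E → ℝ≥0∞} (hv : Measurable v.uncurry) (s σ : ℝ≥0)
    (y : Unit) (a : Fin 2) :
    (stoppingSMDP Q T c g hc hg).actionCost (extendZero v) s σ (Sum.inr y) a = 0 := by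
  rw [actionCost_eq_of_stop Q T hc hg hv]
  · simp [SMDP.stageCost, stoppingSMDP, runCost, termCost]
  · simp [transition]

/-- As `s ≤ T`, the sojourn of length `T + 1` after stopping at `σ ≤ s` contains `s`, so `g` is
due. -/
theorem actionCost_stop {v : ℝ≥0 → E → ℝ≥0∞} (hv : Measurable v.uncurry) {s : ℝ≥0} (hs : s ≤ T)
    (σ : ℝ≥0) (x : E) :
    (stoppingSMDP Q T c g hc hg).actionCost (extendZero v) s σ (Sum.inl x) 1
      = if σ ≤ s then (g x : ℝ≥0∞) else 0 := by
  have hlt : s < σ + (T + 1) :=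
    (hs.trans_lt (lt_add_of_pos_right T one_pos)).trans_le le_add_self
  rw [actionCost_eq_of_stop Q T hc hg hv]
  · simp [SMDP.stageCost, stoppingSMDP, runCost, termCost, hlt]
  · simp [transition]

theorem actionCost_continue {v : ℝ≥0 → E → ℝ≥0∞} (hv : Measurable v.uncurry) (s σ : ℝ≥0)
    (x : E) :
    (stoppingSMDP Q T c g hc hg).actionCost (extendZero v) s σ (Sum.inl x) 0
      = SMP.contCost Q c v (s - σ) x := by
  have hm : Measurable fun p : ℝ≥0 × (E ⊕ Unit) =>
      (stoppingSMDP Q T c g hc hg).stageCost s σ (Sum.inl x) 0 p.1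
        + extendZero v (s - σ - p.1) p.2 :=
    ((stoppingSMDP Q T c g hc hg).measurable_stageCost_add (measurable_extendZero hv) s).comp
      (f := fun p => ((σ, Sum.inl x), ((0 : Fin 2), p))) (by fun_prop)
  have h1 : (stoppingSMDP Q T c g hc hg).actionCost (extendZero v) s σ (Sum.inl x) 0
      = ∫⁻ p, ((stoppingSMDP Q T c g hc hg).stageCost s σ (Sum.inl x) 0 p.1
          + extendZero v (s - σ - p.1) p.2)
          ∂((Q.toKernel x).map (Prod.map id Sum.inl)) := rfl
  rw [h1, lintegral_map hm (measurable_id.prodMap measurable_inl)]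
  refine lintegral_congr fun p => ?_
  simp [SMDP.stageCost, stoppingSMDP, runCost, termCost, extendZero]

theorem extendZero_valueIter_le_actionCost {s : ℝ≥0} (hs : s ≤ T) (n : ℕ) (σ : ℝ≥0)
    (x : E ⊕ Unit) (a : Fin 2) :
    extendZero (SMP.valueIter Q c g (n + 1)) (s - σ) x
      ≤ (stoppingSMDP Q T c g hc hg).actionCost (extendZero (SMP.valueIter Q c g n)) s σ x a := by
  have hv := SMP.measurable_valueIter Q hc hg n
  rcases x with x | y
  · change SMP.valueIter Q c g (n + 1) (s - σ) x ≤ _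
    by_cases ha : a = 0
    · rw [ha, actionCost_continue Q T hc hg hv, SMP.valueIter_succ]
      exact min_le_left _ _
    · rw [Fin.eq_one_of_ne_zero a ha, actionCost_stop Q T hc hg hv hs]
      split_ifs with h
      · rw [SMP.valueIter_succ]
        exact min_le_right _ _
      · rw [tsub_eq_zero_of_le (not_le.1 h).le, SMP.valueIter_zero_horizon]
  · exact zero_le

theorem valueIter_le_policy_expectedCost {s : ℝ≥0} (hs : s ≤ T)
    (π : (stoppingSMDP Q T c g hc hg).Policy) (N : ℕ) (x : E) :
    SMP.valueIter Q c g N s x ≤ π.expectedCost s (Sum.inl x) :=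
  π.le_expectedCost (v := fun n => extendZero (SMP.valueIter Q c g n))
    (fun n => measurable_extendZero (SMP.measurable_valueIter Q hc hg n))
    (fun _ x => by rcases x with x | x <;> rfl)
    (fun n σ x a => extendZero_valueIter_le_actionCost Q T hc hg hs n σ x a) N (Sum.inl x)

open Classical in
/-- The action of the greedy rule at remaining horizon `p.1` in state `p.2`. It continues when the
remaining horizon is `0`, where stopping would incur the terminal cost. -/
noncomputable def greedyAction (c g : E → ℝ≥0) (p : ℝ × (E ⊕ Unit)) : Fin 2 :=
  Sum.elim (fun y => if 0 < p.1 ∧ (g y : ℝ≥0∞)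
    ≤ SMP.contCost Q c (SMP.valueLimit Q c g) p.1.toNNReal y then 1 else 0) (fun _ => 1) p.2

include hc hg in
theorem measurable_greedyAction : Measurable (greedyAction Q c g) := by
  classical
  have hC := SMP.measurable_contCost Q hc (SMP.measurable_valueLimit Q hc hg)
  have h1 : Measurable fun q : ℝ × E => (g q.2 : ℝ≥0∞) := by fun_prop
  have h2 : Measurable fun q : ℝ × E =>
      (SMP.contCost Q c (SMP.valueLimit Q c g)).uncurry (q.1.toNNReal, q.2) := by fun_prop
  refine measurable_sumElim_snd (f := fun q : ℝ × E => if 0 < q.1 ∧ (g q.2 : ℝ≥0∞)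
    ≤ SMP.contCost Q c (SMP.valueLimit Q c g) q.1.toNNReal q.2 then (1 : Fin 2) else 0) ?_ 1
  exact Measurable.ite ((measurableSet_lt measurable_const measurable_fst).inter
    (measurableSet_le h1 h2)) measurable_const measurable_const

theorem greedyAction_mem_adm (p : ℝ × (E ⊕ Unit)) : greedyAction Q c g p ∈ adm p.2 := by
  rcases p with ⟨r, x | y⟩
  · simp only [greedyAction, adm, Sum.elim_inl]
    split_ifs <;> simp
  · simp [greedyAction, adm]

theorem actionCost_greedyAction_le {s : ℝ≥0} (hs : s ≤ T) (σ : ℝ≥0) (x : E ⊕ Unit) :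
    (stoppingSMDP Q T c g hc hg).actionCost (extendZero (SMP.valueLimit Q c g)) s σ x
        (greedyAction Q c g ((s : ℝ) - σ, x))
      ≤ extendZero (SMP.valueLimit Q c g) (s - σ) x := by
  have hv := SMP.measurable_valueLimit Q hc hg
  rcases x with x | y
  · change _ ≤ SMP.valueLimit Q c g (s - σ) x
    simp only [greedyAction, Sum.elim_inl, ← NNReal.sub_def, sub_pos, NNReal.coe_lt_coe]
    split_ifs with h
    · rw [actionCost_stop Q T hc hg hv hs, if_pos h.1.le, SMP.valueLimit_eq_min Q hc hg]
      exact le_min h.2 le_rfl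
    · rw [actionCost_continue Q T hc hg hv]
      by_cases hσ : σ < s
      · rw [SMP.valueLimit_eq_min Q hc hg]
        exact le_min le_rfl (not_le.1 fun h' => h ⟨hσ, h'⟩).le
      · rw [tsub_eq_zero_of_le (not_lt.1 hσ),
          SMP.contCost_zero Q c (SMP.valueLimit_zero_horizon Q c g)]
        exact zero_le
  · rw [actionCost_cemetery Q T hc hg hv]
    exact zero_le

theorem value_eq_valueLimit {s : ℝ≥0} (hs : s ≤ T) (x : E) :
    (stoppingSMDP Q T c g hc hg).value s (Sum.inl x) = SMP.valueLimit Q c g s x := by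
  refine le_antisymm ?_ (le_iInf fun π => iSup_le fun N =>
    valueIter_le_policy_expectedCost Q T hc hg hs π N x)
  refine iInf_le_of_le (SMDP.Policy.ofSelector (stoppingSMDP Q T c g hc hg) (greedyAction Q c g)
    (measurable_greedyAction Q hc hg) (greedyAction_mem_adm Q)) ?_
  refine SMDP.Policy.expectedCost_le _
    (measurable_extendZero (SMP.measurable_valueLimit Q hc hg)) (fun n ω => ?_) (Sum.inl x)
  exact (SMDP.Policy.lintegral_actionKernel_ofSelector _ _ s n ω _).trans_le
    (actionCost_greedyAction_le Q T hc hg hs _ _)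

end StoppingSMDP

theorem mainTheorem5 {E : Type*} [MeasurableSpace E] [StandardBorelSpace E]
    (Q : SemiMarkovKernel E E) (hQ : Q.Regular)
    (c g : E → ℝ≥0) (hc : Measurable c) (hg : Measurable g) (T : ℝ≥0) :
    (∀ n, Measurable fun p : Set.Iic T × E => SMP.valueIter Q c g n p.1 p.2) ∧
    (Measurable fun p : Set.Iic T × E => SMP.value Q c g p.1 p.2) ∧
    (∀ s ≤ T, ∀ x : E,
      Tendsto (fun n => SMP.valueIter Q c g n s x) atTop (𝓝 (SMP.value Q c g s x))) ∧
    (∀ s ≤ T, ∀ x : E,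
      SMP.value Q c g s x = SMP.bellman Q c g (SMP.value Q c g) s x) ∧
    (∀ s ≤ T, ∀ x : E,
      SMP.value Q c g s x = (stoppingSMDP Q T c g hc hg).value s (Sum.inl x)) := by
  have hval : SMP.value Q c g = SMP.valueLimit Q c g := by
    ext s x
    exact SMP.value_eq_valueLimit Q hc hg s x
  have hcoe : Measurable fun p : Set.Iic T × E => ((p.1 : ℝ≥0), p.2) := by fun_prop
  rw [hval]
  exact ⟨fun n => (SMP.measurable_valueIter Q hc hg n).comp hcoe,
    (SMP.measurable_valueLimit Q hc hg).comp hcoe,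
    fun s _ x => SMP.tendsto_valueIter Q c g s x,
    fun s _ x => SMP.valueLimit_eq_bellman Q hc hg s x,
    fun s hs x => (StoppingSMDP.value_eq_valueLimit Q T hc hg hs x).symm⟩
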